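/- Let $m=(m_0,m_1,\dots)$ be a bounded sequence of integers $m_k\ge 2$, let $G_m=\prod_{k}\mathbb Z/m_k\mathbb Z$ be the corresponding bounded Vilenkin group with normalized Haar measure (the product of the uniform measures), and put $M_0=1$, $M_{k+1}=m_kM_k$. Write each $n\in\mathbb N$ as $n=\sum_k n_kM_k$ with $0\le n_k<m_k$, and let $\psi_n(x)=\prod_k r_k(x)^{n_k}$ with $r_k(x)=\exp(2\pi i x_k/m_k)$ be the Vilenkin system. Let $\mu$ be the product measure on $G_m^2=G_m\times G_m$; $L^p(G_m^2)$ is the usual complex Lebesgue space for $1\le p<\infty$, and $L^\infty(G_m^2)$ denotes the space $C(G_m^2)$ of continuous functions with the supremum norm. For $f\in L^p(G_m^2)$ let $\widehat f(k_1,k_2)=\int_{G_m^2} f(x,y)\overline{\psi_{k_1}(x)}\,\overline{\psi_{k_2}(y)}\,d\mu(x,y)$ and $S_{j,j}(f)(x,y)=\sum_{k_1=0}^{j-1}\sum_{k_2=0}^{j-1}\widehat f(k_1,k_2)\psi_{k_1}(x)\psi_{k_2}(y)$, and define the $(C,-\alpha)$ means of the quadratic partial sums by $$\sigma_n^{-\alpha}(f)=\frac1{A_{n-1}^{-\alpha}}\sum_{j=1}^{n}A_{n-j}^{-\alpha-1}S_{j,j}(f),\qquad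 A_0^{\beta}=1,\quad A_n^{\beta}=\frac{(\beta+1)\cdots(\beta+n)}{n!}.$$ Let $I_n=\{u\in G_m: u_0=\dots=u_{n-1}=0\}$ and let $$\omega_1(f,1/M_n)_p=\sup_{u\in I_n}\|f(\cdot+u,\cdot)-f\|_p,\qquad \omega_2(f,1/M_n)_p=\sup_{v\in I_n}\|f(\cdot,\cdot+v)-f\|_p$$ be the partial moduli of continuity. Let $\alpha\in(0,1)$. Then there is a constant $c(\alpha)$, depending only on $\alpha$ and on an upper bound for the sequence $m$, such that for every $p\in[1,\infty]$, every $f\in L^p(G_m^2)$, and all integers $k\ge 1$ and $n$ with $M_k\le n<M_{k+1}$, $$\|\sigma_n^{-\alpha}(f)-f\|_p\le c(\alpha)\Big(M_k^{\alpha}\log n\,\big(\omega_1(f,1/M_{k-1})_p+\omega_2(f,1/M_{k-1})_p\big)+\sum_{r=0}^{k-2}\frac{M_r}{M_k}\big(\omega_1(f,1/M_r)_p+\omega_2(f,1/M_r)_p\big)\Big),$$ where the sum is empty for $k=1$. -/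

import Mathlib

open MeasureTheory
open scoped ENNReal NNReal

noncomputable section

namespace Vilenkin

/-- The Vilenkin group `G_m`, the complete direct product of the groups `ℤ / m_k ℤ`; addition is
coordinatewise and the topology is the product of the discrete topologies. -/
abbrev G (m : ℕ → ℕ) : Type := (k : ℕ) → ZMod (m k)

/-- The Haar measure of `G_m`: the product of the uniform probability measures on `ℤ / m_k ℤ`. -/
def haar (m : ℕ → ℕ) : Measure (G m) :=
  Measure.infinitePi fun k => ProbabilityTheory.uniformOn (Set.univ : Set (ZMod (m k)))

/-- The Haar measure of the two-dimensional group `G_m × G_m`. -/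
def haar2 (m : ℕ → ℕ) : Measure (G m × G m) := (haar m).prod (haar m)

/-- The generalized powers `M_0 = 1`, `M_{k+1} = m_k M_k`. -/
def M (m : ℕ → ℕ) : ℕ → ℕ
  | 0 => 1
  | k + 1 => m k * M m k

/-- The `k`-th digit `n_k` of `n` in the generalized number system, `n = ∑ n_k M_k`. -/
def digit (m : ℕ → ℕ) (n k : ℕ) : ℕ := n / M m k % m k

lemma lt_M (m : ℕ → ℕ) (hm : ∀ k, 2 ≤ m k) (n : ℕ) : n < M m n := by
  induction n with
  | zero => simp [M]
  | succ n ih =>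
    have h : 2 * M m n ≤ m n * M m n := Nat.mul_le_mul_right _ (hm n)
    simp only [M]
    omega

/-- The digits of `n` with index at least `n` vanish. -/
lemma digit_eq_zero (m : ℕ → ℕ) (hm : ∀ k, 2 ≤ m k) {n k : ℕ} (h : n ≤ k) :
    digit m n k = 0 := by
  simp [digit, Nat.div_eq_of_lt (h.trans_lt (lt_M m hm k))]

/-- The digits of `n` are its expansion in the generalized number system. -/
lemma sum_digit (m : ℕ → ℕ) (n N : ℕ) :
    ∑ k ∈ Finset.range N, digit m n k * M m k = n % M m N := by
  induction N with
  | zero => simp [M, Nat.mod_one]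
  | succ N ih =>
    rw [Finset.sum_range_succ, ih, M, mul_comm (m N), Nat.mod_mul, digit, mul_comm (M m N)]

/-- The neighbourhood `I_n(x)`. -/
def I (m : ℕ → ℕ) (n : ℕ) (x : G m) : Set (G m) := {y | ∀ j < n, y j = x j}

/-- The generalized Rademacher functions `r_k(x) = exp(2πi x_k / m_k)`. -/
def rademacher (m : ℕ → ℕ) (k : ℕ) (x : G m) : ℂ :=
  Complex.exp (2 * Real.pi * Complex.I * ((x k).val : ℂ) / (m k : ℂ))

/-- The Vilenkin functions `ψ_n = ∏_k r_k ^ n_k`. The product over all `k` reduces to `k < n`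
because the other digits of `n` vanish (`digit_eq_zero`). -/
def psi (m : ℕ → ℕ) (n : ℕ) (x : G m) : ℂ :=
  ∏ k ∈ Finset.range n, rademacher m k x ^ digit m n k

/-- The two-dimensional Vilenkin-Fourier coefficients. -/
def fourierCoeff (m : ℕ → ℕ) (f : G m × G m → ℂ) (n₁ n₂ : ℕ) : ℂ :=
  ∫ z, f z * (starRingEnd ℂ) (psi m n₁ z.1) * (starRingEnd ℂ) (psi m n₂ z.2) ∂(haar2 m)

/-- The rectangular partial sums `S_{n₁,n₂}(x, y, f)`, `z = (x, y)`. -/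
def partialSum (m : ℕ → ℕ) (f : G m × G m → ℂ) (n₁ n₂ : ℕ) (z : G m × G m) : ℂ :=
  ∑ k₁ ∈ Finset.range n₁, ∑ k₂ ∈ Finset.range n₂,
    fourierCoeff m f k₁ k₂ * psi m k₁ z.1 * psi m k₂ z.2

/-- The Cesàro numbers `A_n^β = (β + 1) ⋯ (β + n) / n!`, with `A_0^β = 1`. -/
def cesaroA (β : ℝ) (n : ℕ) : ℝ :=
  (∏ i ∈ Finset.range n, (β + (i + 1))) / (n.factorial : ℝ)

/-- The `(C, -α)` means
`σ_n^{-α}(f) = (1 / A_{n-1}^{-α}) ∑_{j=1}^n A_{n-j}^{-α-1} S_{j,j}(f)` of the quadratic partial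
sums, for `n ≥ 1`. -/
def sigma (m : ℕ → ℕ) (α : ℝ) (n : ℕ) (f : G m × G m → ℂ) (z : G m × G m) : ℂ :=
  ((cesaroA (-α) (n - 1))⁻¹ : ℝ) *
    ∑ j ∈ Finset.Icc 1 n, (cesaroA (-α - 1) (n - j) : ℂ) * partialSum m f j j z

/-- Membership in `L^p(G_m²)`, where `L^∞` stands for the class of continuous functions. (For a
continuous function, `eLpNorm f ∞` is the supremum norm, since nonempty open sets have positive
measure.) -/
def InLp (m : ℕ → ℕ) (p : ℝ≥0∞) (f : G m × G m → ℂ) : Prop :=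
  MemLp f p (haar2 m) ∧ (p = ∞ → Continuous f)

/-- The partial modulus of continuity `ω₁(f, 1 / M_n)_p`. -/
def omega1 (m : ℕ → ℕ) (f : G m × G m → ℂ) (n : ℕ) (p : ℝ≥0∞) : ℝ≥0∞ :=
  ⨆ u ∈ I m n 0, eLpNorm (fun z => f (z.1 + u, z.2) - f z) p (haar2 m)

/-- The partial modulus of continuity `ω₂(f, 1 / M_n)_p`. -/
def omega2 (m : ℕ → ℕ) (f : G m × G m → ℂ) (n : ℕ) (p : ℝ≥0∞) : ℝ≥0∞ :=
  ⨆ v ∈ I m n 0, eLpNorm (fun z => f (z.1, z.2 + v) - f z) p (haar2 m)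

end Vilenkin

end

/-! The weights `A_{n-j}^{-α-1}`, `1 ≤ j ≤ n`, add up to `A_{n-1}^{-α}`, so `σ_n f - f` is `1 /
A_{n-1}^{-α}`, of order `M_k^α`, times the weighted sum of the differences `S_{j,j} f - f`. The
range of `j` is cut into the blocks `[M_r, M_{r+1})` with `r < k - 1` and the last block `[M_{k-1},
n]`.

On a block starting at `N = M_r`, the function `f` may be replaced by `h = f - S_{N,N} f`, because
`S_{j,j}` fixes `S_{N,N} f` for `j ≥ N` (`partialSum_sub_self`). Since `S_{N,N}` averages over
cosets of `I_r × I_r`, `‖h‖_p ≤ ω₁ + ω₂` at level `r` (`eLpNorm_sub_partialSum_M_le`). By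
Minkowski's inequality it then suffices to bound the `L^1` norms of two kinds of kernels, uniformly
in `p`.

For the short blocks, the weights are `O(M_k^{-α-1})`, and a sum of `D_j(x) D_j(y)` over `j < M_K`
with weights at most `W` has `L^1` norm `O(W M_K)` (`integral_norm_quadKernel_le`). The proof fixes
the scale `s` at which the pair `(x, y)` leaves `I_s × I_s`; orthogonality of the characters `ψ_{N
M_{s+1}}` gains a square root over the trivial bound, and this makes the sum over scales converge.
After multiplication by `M_k^α` the block contributes `M_r / M_k`.

The last block is the whole Cesàro kernel minus its part with `j < M_{k-1}`; the latter is of the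
previous kind. The whole kernel has `L^1` norm `O(k) = O(log n)` (`integral_norm_cesaroKernel_le`):
at scale `s` it is at most a constant times `scaleBound` times `M_s` times a majorant of the
Dirichlet kernels (`norm_cesaroKernel_le`). The majorant has integral at most `K + 1`, and the sum
of `scaleBound` over `s` is bounded independently of `n` (`sum_scaleBound_le`). -/

namespace Vilenkin

/-! ### Size and summation of the Cesàro numbers of orders `-α` and `-α - 1`. -/

section CesaroNumbers

lemma cesaroA_zero (β : ℝ) : cesaroA β 0 = 1 := by simp [cesaroA]

lemma cesaroA_succ (β : ℝ) (n : ℕ) :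
    cesaroA β (n + 1) = cesaroA β n * ((β + (n + 1)) / (n + 1)) := by
  have h : (n.factorial : ℝ) ≠ 0 := by positivity
  have h' : (n : ℝ) + 1 ≠ 0 := by positivity
  simp only [cesaroA, Finset.prod_range_succ, Nat.factorial_succ]
  push_cast
  field_simp

lemma cesaroA_sub_one_succ (β : ℝ) (n : ℕ) :
    cesaroA (β - 1) (n + 1) = β / (n + 1) * cesaroA β n := by
  have h : (n.factorial : ℝ) ≠ 0 := by positivity
  have h' : (n : ℝ) + 1 ≠ 0 := by positivity
  have e : ∀ i : ℕ, β - 1 + (((i + 1 : ℕ) : ℝ) + 1) = β + (i + 1) := by intro i; push_cast; ring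
  simp only [cesaroA, Finset.prod_range_succ', Nat.factorial_succ, e]
  push_cast
  field_simp
  ring

lemma sum_cesaroA_sub_one (β : ℝ) (n : ℕ) :
    ∑ i ∈ Finset.range (n + 1), cesaroA (β - 1) i = cesaroA β n := by
  induction n with
  | zero => simp [cesaroA_zero]
  | succ n ih =>
    have h' : (n : ℝ) + 1 ≠ 0 := by positivity
    rw [Finset.sum_range_succ, ih, cesaroA_sub_one_succ, cesaroA_succ]
    field_simp
    ring

variable {α : ℝ}

lemma cesaroA_neg_pos (h1 : α < 1) (n : ℕ) : 0 < cesaroA (-α) n := by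
  induction n with
  | zero => simp [cesaroA_zero]
  | succ n ih =>
    rw [cesaroA_succ]
    have : (0 : ℝ) < -α + (n + 1) := by have := n.cast_nonneg (α := ℝ); linarith
    positivity

lemma cesaroA_neg_le (h0 : 0 < α) (h1 : α < 1) (n : ℕ) :
    cesaroA (-α) n ≤ ((n : ℝ) + 1) ^ (-α) := by
  induction n with
  | zero => simp [cesaroA_zero]
  | succ n ih =>
    have hn : (0 : ℝ) < n + 1 := by positivity
    have hn2 : (0 : ℝ) < n + 2 := by positivity
    -- The ratio of consecutive terms is `1 - α/(n+1)`; combine `1 + x ≤ exp x` with `log t ≤ t -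
    -- 1`.
    have key : (-α + (n + 1)) / ((n : ℝ) + 1) ≤ (((n : ℝ) + 2) / (n + 1)) ^ (-α) := by
      have e : (-α + (n + 1)) / ((n : ℝ) + 1) = 1 + (-α) * (1 / (n + 1)) := by field_simp; ring
      have hx : (0 : ℝ) < ((n : ℝ) + 2) / (n + 1) := by positivity
      have h2 : Real.log (((n : ℝ) + 2) / (n + 1)) ≤ 1 / (n + 1) := by
        refine (Real.log_le_sub_one_of_pos hx).trans (le_of_eq ?_)
        field_simp
        ring
      rw [e, Real.rpow_def_of_pos hx]
      have h3 := Real.add_one_le_exp (Real.log (((n : ℝ) + 2) / (n + 1)) * -α)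
      have h4 := mul_le_mul_of_nonneg_left h2 h0.le
      linarith
    rw [cesaroA_succ]
    have h5 : (0 : ℝ) ≤ (-α + (n + 1)) / ((n : ℝ) + 1) := by
      have := n.cast_nonneg (α := ℝ)
      apply div_nonneg <;> linarith
    calc _ ≤ ((n : ℝ) + 1) ^ (-α) * (((n : ℝ) + 2) / (n + 1)) ^ (-α) := by gcongr
      _ = _ := by
        rw [← Real.mul_rpow hn.le (by positivity)]
        congr 1
        push_cast
        field_simp
        ring

lemma le_cesaroA_neg (h0 : 0 < α) (h1 : α < 1) (n : ℕ) :
    (1 - α) * ((n : ℝ) + 1) ^ (-α) ≤ cesaroA (-α) n := by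
  -- With the index shifted by one, the ratio `1 - α/(n+2)` is at least `((n+1)/(n+2))^α` by
  -- Bernoulli's inequality for exponents in `[0, 1]`, and these factors telescope.
  have key : ∀ n : ℕ, (1 - α) * ((n : ℝ) + 1) ^ (-α) ≤ cesaroA (-α) (n + 1) := by
    intro n
    induction n with
    | zero => simp [cesaroA_succ, cesaroA_zero, sub_eq_neg_add]
    | succ n ih =>
      have hn : (0 : ℝ) < n + 1 := by positivity
      have hn2 : (0 : ℝ) < n + 2 := by positivity
      have hb := rpow_one_add_le_one_add_mul_self (s := -1 / ((n : ℝ) + 2)) (p := α)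
        (by rw [le_div_iff₀ hn2]; linarith) h0.le h1.le
      rw [cesaroA_succ]
      have h6 : (0 : ℝ) ≤ (1 - α) * ((n : ℝ) + 1) ^ (-α) :=
        mul_nonneg (by linarith) (by positivity)
      have e1 : (-α + (((n + 1 : ℕ) : ℝ) + 1)) / (((n + 1 : ℕ) : ℝ) + 1)
          = 1 + α * (-1 / ((n : ℝ) + 2)) := by push_cast; field_simp; ring
      rw [e1]
      have e2 : 1 + -1 / ((n : ℝ) + 2) = (n + 1) / (n + 2) := by field_simp; ring
      rw [e2] at hb
      calc _ = ((1 - α) * ((n : ℝ) + 1) ^ (-α)) * (((n : ℝ) + 1) / (n + 2)) ^ α := by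
            rw [mul_assoc, Real.div_rpow hn.le hn2.le, Real.rpow_neg hn.le, ← mul_div_assoc,
              inv_mul_cancel₀ (by positivity), Real.rpow_neg (by positivity), one_div]
            push_cast
            ring_nf
        _ ≤ _ := by
            have := (cesaroA_neg_pos h1 (n + 1)).le
            gcongr
  cases n with
  | zero => simp [cesaroA_zero]; linarith
  | succ n =>
    refine le_trans ?_ (key n)
    have : (0 : ℝ) ≤ 1 - α := by linarith
    refine mul_le_mul_of_nonneg_left ?_ this
    apply Real.rpow_le_rpow_of_nonpos (by positivity) (by push_cast; linarith) (by linarith)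

lemma abs_cesaroA_sub_one_succ (h0 : 0 < α) (h1 : α < 1) (n : ℕ) :
    |cesaroA (-α - 1) (n + 1)| = α / (n + 1) * cesaroA (-α) n := by
  rw [cesaroA_sub_one_succ, abs_mul, abs_of_pos (cesaroA_neg_pos h1 n), abs_div, abs_neg,
    abs_of_pos h0, abs_of_pos (by positivity)]

lemma abs_cesaroA_sub_one_le (h0 : 0 < α) (h1 : α < 1) {n : ℕ} (hn : 1 ≤ n) :
    |cesaroA (-α - 1) n| ≤ (n : ℝ) ^ (-α - 1) := by
  obtain ⟨n, rfl⟩ := Nat.exists_eq_add_of_le' hn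
  rw [abs_cesaroA_sub_one_succ h0 h1, Real.rpow_sub_one (by positivity)]
  push_cast
  calc _ ≤ 1 / ((n : ℝ) + 1) * ((n : ℝ) + 1) ^ (-α) := by
        have := (cesaroA_neg_pos h1 n).le
        have := cesaroA_neg_le h0 h1 n
        gcongr
    _ = _ := by ring

/-- For positive index the numbers of order `-α - 1` are negative differences of those of order
`-α`, so sums of their absolute values telescope. -/
lemma abs_cesaroA_sub_one_succ_eq (h0 : 0 < α) (h1 : α < 1) (n : ℕ) :
    |cesaroA (-α - 1) (n + 1)| = cesaroA (-α) n - cesaroA (-α) (n + 1) := by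
  have h' : (n : ℝ) + 1 ≠ 0 := by positivity
  rw [abs_cesaroA_sub_one_succ h0 h1, cesaroA_succ]
  field_simp
  ring

lemma sum_Ico_abs_cesaroA_le (h0 : 0 < α) (h1 : α < 1) (q R : ℕ) :
    ∑ i ∈ Finset.Ico (q + 1) R, |cesaroA (-α - 1) i| ≤ ((q : ℝ) + 1) ^ (-α) := by
  rcases le_or_gt R (q + 1) with h | h
  · rw [Finset.Ico_eq_empty (by omega)]; simp; positivity
  obtain ⟨d, rfl⟩ := Nat.exists_eq_add_of_lt h
  have : ∀ d : ℕ, ∑ i ∈ Finset.Ico (q + 1) (q + 1 + d), |cesaroA (-α - 1) i|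
      = cesaroA (-α) q - cesaroA (-α) (q + d) := by
    intro d
    induction d with
    | zero => simp
    | succ d ih =>
      rw [← add_assoc, Finset.sum_Ico_succ_top (by omega), ih, show q + 1 + d = (q + d) + 1 by ring,
        abs_cesaroA_sub_one_succ_eq h0 h1]
      ring_nf
  rw [add_assoc, this]
  have := cesaroA_neg_le h0 h1 q
  have := cesaroA_neg_pos h1 (q + (d + 1))
  linarith

lemma sum_range_abs_cesaroA_le (h0 : 0 < α) (h1 : α < 1) (R : ℕ) :
    ∑ i ∈ Finset.range R, |cesaroA (-α - 1) i| ≤ 2 := by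
  cases R with
  | zero => simp
  | succ R =>
    have := sum_Ico_abs_cesaroA_le h0 h1 0 (R + 1)
    rw [Finset.range_eq_Ico, Finset.sum_eq_sum_Ico_succ_bot (by omega)]
    simp [cesaroA_zero] at this ⊢
    linarith

lemma sum_cesaroA_neg (h1 : α < 1) (n : ℕ) :
    ∑ i ∈ Finset.range (n + 1), cesaroA (-α) i = cesaroA (-α) n * ((n + 1 - α) / (1 - α)) := by
  have h2 : (1 : ℝ) - α ≠ 0 := by linarith
  induction n with
  | zero => simp [cesaroA_zero]; field_simp
  | succ n ih =>
    have h' : (n : ℝ) + 1 ≠ 0 := by positivity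
    rw [Finset.sum_range_succ, ih, cesaroA_succ]
    push_cast
    field_simp
    ring

/-- The factor `i` cancels the denominator: `i |A_i^{-α-1}| = α A_{i-1}^{-α}`, whose partial sums
are known in closed form. -/
lemma sum_abs_cesaroA_mul_le (h0 : 0 < α) (h1 : α < 1) (R : ℕ) :
    ∑ i ∈ Finset.range (R + 1), |cesaroA (-α - 1) i| * i ≤ (R : ℝ) ^ (1 - α) / (1 - α) := by
  have h2 : (0 : ℝ) < 1 - α := by linarith
  rw [Finset.sum_range_succ']
  have e : ∀ i : ℕ, |cesaroA (-α - 1) (i + 1)| * ((i + 1 : ℕ) : ℝ) = α * cesaroA (-α) i := by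
    intro i
    rw [abs_cesaroA_sub_one_succ h0 h1]
    push_cast
    field_simp
  simp only [e, Nat.cast_zero, mul_zero, add_zero, ← Finset.mul_sum]
  cases R with
  | zero => simp; positivity
  | succ n =>
    rw [sum_cesaroA_neg h1, ← mul_div_assoc, ← mul_div_assoc]
    gcongr
    have hA := cesaroA_neg_le h0 h1 n
    have hA' := (cesaroA_neg_pos h1 n).le
    have hn : (0 : ℝ) < n + 1 := by positivity
    calc α * (cesaroA (-α) n * (n + 1 - α)) ≤ 1 * (((n : ℝ) + 1) ^ (-α) * (n + 1)) := by
          gcongr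
          · have := n.cast_nonneg (α := ℝ)
            exact mul_nonneg hA' (by linarith)
          · linarith
          · linarith
      _ = _ := by
        rw [one_mul, ← Real.rpow_add_one hn.ne']
        push_cast
        congr 1
        ring

end CesaroNumbers

end Vilenkin

namespace Vilenkin

/-! ### Invariance of the Haar measure and the measure of `I_s`. -/

section HaarMeasure

variable {m : ℕ → ℕ}

lemma M_pos (hm : ∀ k, 2 ≤ m k) (k : ℕ) : 0 < M m k := (Nat.zero_le _).trans_lt (lt_M m hm k)

lemma M_eq_prod (k : ℕ) : M m k = ∏ i ∈ Finset.range k, m i := by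
  induction k with
  | zero => simp [M]
  | succ k ih => rw [M, ih, Finset.prod_range_succ, mul_comm]

variable [∀ k, NeZero (m k)]

instance : IsProbabilityMeasure (haar m) := by unfold haar; infer_instance

instance : IsProbabilityMeasure (haar2 m) := by unfold haar2; infer_instance

lemma map_add_left_uniformOn (N : ℕ) [NeZero N] (a : ZMod N) :
    (ProbabilityTheory.uniformOn (Set.univ : Set (ZMod N))).map (a + ·)
      = ProbabilityTheory.uniformOn (Set.univ : Set (ZMod N)) := by
  ext s hs
  rw [Measure.map_apply (measurable_of_finite _) hs, ProbabilityTheory.uniformOn_univ,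
    ProbabilityTheory.uniformOn_univ]
  congr 1
  rw [Measure.count_apply ((measurable_of_finite _) hs), Measure.count_apply hs,
    show (fun x => a + x) = Equiv.addLeft a from rfl,
    Set.encard_preimage_of_bijective (Equiv.addLeft a).bijective]

instance : Measure.IsAddLeftInvariant (haar m) where
  map_add_left_eq_self g := by
    have := Measure.infinitePi_map_pi
      (μ := fun k => ProbabilityTheory.uniformOn (Set.univ : Set (ZMod (m k))))
      (f := fun k x => g k + x) (fun k => measurable_of_finite _)
    simp only [map_add_left_uniformOn] at this
    exact this

instance : MeasurableAdd (G m) where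
  measurable_const_add c := measurable_pi_lambda _ fun k =>
    (measurable_of_finite (c k + ·)).comp (measurable_pi_apply k)
  measurable_add_const c := measurable_pi_lambda _ fun k =>
    (measurable_of_finite (· + c k)).comp (measurable_pi_apply k)

instance : MeasurableAdd₂ (G m) where
  measurable_add := measurable_pi_lambda _ fun k =>
    show Measurable ((fun p : ZMod (m k) × ZMod (m k) => p.1 + p.2) ∘
      fun q : G m × G m => (q.1 k, q.2 k)) from
    (measurable_of_finite _).comp (((measurable_pi_apply k).comp measurable_fst).prodMk
      ((measurable_pi_apply k).comp measurable_snd))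

instance : Measure.IsAddLeftInvariant (haar2 m) :=
  Measure.prod.instIsAddLeftInvariant (μ := haar m) (ν := haar m)

omit [∀ k, NeZero (m k)] in
lemma measurableSet_I (s : ℕ) (x : G m) : MeasurableSet (I m s x) := by
  have : I m s x = ⋂ j ∈ Finset.range s, (fun y : G m => y j) ⁻¹' {x j} := by
    ext y; simp [I]
  rw [this]
  exact Finset.measurableSet_biInter _ fun j _ => measurable_pi_apply j (MeasurableSet.singleton _)

lemma haar_I (s : ℕ) (x : G m) : haar m (I m s x) = ((M m s : ℕ) : ℝ≥0∞)⁻¹ := by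
  have : I m s x = Set.pi (Finset.range s) fun j => {x j} := by
    ext y; simp [I, Set.mem_pi]
  rw [this, haar, Measure.infinitePi_pi _ (fun _ _ => MeasurableSet.singleton _)]
  have e : ∀ i, ProbabilityTheory.uniformOn (Set.univ : Set (ZMod (m i))) {x i}
      = ((m i : ℕ) : ℝ≥0∞)⁻¹ := by
    intro i
    rw [ProbabilityTheory.uniformOn_univ]
    simp [ZMod.card]
  simp only [e]
  rw [M_eq_prod]
  push_cast
  rw [ENNReal.prod_inv_distrib]
  intro i _ j _ _
  exact Or.inr (ENNReal.natCast_ne_top _)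

lemma haar_real_I (s : ℕ) (x : G m) : (haar m).real (I m s x) = ((M m s : ℕ) : ℝ)⁻¹ := by
  simp [Measure.real, haar_I]

end HaarMeasure

end Vilenkin

namespace Vilenkin

/-! ### Digits, Vilenkin characters and their orthogonality. -/

section Characters

variable {m : ℕ → ℕ}

lemma M_dvd_M {s k : ℕ} (h : s ≤ k) : M m s ∣ M m k := by
  induction k, h using Nat.le_induction with
  | base => exact dvd_rfl
  | succ k _ ih => exact ih.trans (Dvd.intro_left (m k) rfl)

lemma M_le_M (hm : ∀ k, 2 ≤ m k) {s k : ℕ} (h : s ≤ k) : M m s ≤ M m k :=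
  Nat.le_of_dvd (M_pos hm k) (M_dvd_M h)

lemma digit_eq_mod_div (n k : ℕ) : digit m n k = n % M m (k + 1) / M m k := by
  rw [digit, M, mul_comm, Nat.mod_mul_right_div_self]

/-- No carry occurs: a multiple of `M_s` has only digits of index at least `s`, and `l < M_s` only
digits of index below `s`. -/
lemma digit_mul_M_add (hm : ∀ k, 2 ≤ m k) (N s l k : ℕ) (hl : l < M m s) :
    digit m (N * M m s + l) k = digit m (N * M m s) k + digit m l k := by
  rcases lt_or_ge k s with h | h
  · obtain ⟨c, hc⟩ := M_dvd_M (m := m) (Nat.succ_le_of_lt h)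
    rw [digit_eq_mod_div, digit_eq_mod_div, digit_eq_mod_div, hc, mul_left_comm,
      Nat.mul_add_mod, Nat.mul_mod_right, Nat.zero_div, zero_add]
  · obtain ⟨c, hc⟩ := M_dvd_M (m := m) h
    have hl0 : l / M m k = 0 := Nat.div_eq_of_lt (hl.trans_le (M_le_M hm h))
    have h1 : (N * M m s + l) / M m s = N := by
      rw [add_comm, Nat.add_mul_div_right _ _ (M_pos hm s), Nat.div_eq_of_lt hl, zero_add]
    have h2 : N * M m s / M m s = N := Nat.mul_div_cancel _ (M_pos hm s)
    simp only [digit, hl0, Nat.zero_mod, add_zero]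
    rw [hc, ← Nat.div_div_eq_div_mul, ← Nat.div_div_eq_div_mul, h1, h2]

lemma digit_eq_zero_of_lt (hm : ∀ k, 2 ≤ m k) {n s k : ℕ} (h : n < M m s) (hk : s ≤ k) :
    digit m n k = 0 := by
  simp [digit, Nat.div_eq_of_lt (h.trans_le (M_le_M hm hk))]

lemma digit_mul_M_of_lt (N : ℕ) {s k : ℕ} (h : k < s) : digit m (N * M m s) k = 0 := by
  obtain ⟨c, hc⟩ := M_dvd_M (m := m) (Nat.succ_le_of_lt h)
  rw [digit_eq_mod_div, hc, mul_left_comm, Nat.mul_mod_right, Nat.zero_div]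

lemma psi_eq_prod (hm : ∀ k, 2 ≤ m k) {n K : ℕ} (h : n ≤ K) (x : G m) :
    psi m n x = ∏ k ∈ Finset.range K, rademacher m k x ^ digit m n k := by
  refine Finset.prod_subset (Finset.range_mono h) fun k _ hk => ?_
  rw [digit_eq_zero m hm (by simpa using hk), pow_zero]

lemma psi_mul_M_add (hm : ∀ k, 2 ≤ m k) (N s l : ℕ) (hl : l < M m s) (x : G m) :
    psi m (N * M m s + l) x = psi m (N * M m s) x * psi m l x := by
  rw [psi_eq_prod hm le_rfl, psi_eq_prod hm (Nat.le_add_right (N * M m s) l),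
    psi_eq_prod hm (Nat.le_add_left l (N * M m s)), ← Finset.prod_mul_distrib]
  refine Finset.prod_congr rfl fun k _ => ?_
  rw [digit_mul_M_add hm N s l k hl, pow_add]

lemma psi_mul_M_of_lt (hm : ∀ k, 2 ≤ m k) {s b : ℕ} (hb : b < m s) (x : G m) :
    psi m (b * M m s) x = rademacher m s x ^ b := by
  have hlt : b * M m s < M m (s + 1) := Nat.mul_lt_mul_of_pos_right hb (M_pos hm s)
  rw [psi_eq_prod hm (Nat.le_add_right (b * M m s) (s + 1)),
    Finset.prod_eq_single_of_mem s (by simp; omega)]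
  · rw [digit, Nat.mul_div_cancel _ (M_pos hm s), Nat.mod_eq_of_lt hb]
  · intro k _ hk
    rcases lt_or_gt_of_ne hk with h | h
    · rw [digit_mul_M_of_lt _ h, pow_zero]
    · rw [digit_eq_zero_of_lt hm hlt h, pow_zero]

lemma mem_I_zero {s : ℕ} {x : G m} : x ∈ I m s 0 ↔ ∀ j < s, x j = 0 := Iff.rfl

lemma I_antitone {s t : ℕ} (h : s ≤ t) {x : G m} (hx : x ∈ I m t 0) : x ∈ I m s 0 :=
  fun j hj => hx j (hj.trans_le h)

lemma mem_I_succ {s : ℕ} {x : G m} : x ∈ I m (s + 1) 0 ↔ x ∈ I m s 0 ∧ x s = 0 := by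
  constructor
  · exact fun h => ⟨I_antitone (by omega) h, h s (by omega)⟩
  · rintro ⟨h, h'⟩ j hj
    rcases Nat.lt_succ_iff_lt_or_eq.1 hj with hj | rfl
    exacts [h j hj, h']

lemma exists_mem_I_ne_zero {K : ℕ} {x : G m} (h : x ∉ I m K 0) :
    ∃ s < K, x ∈ I m s 0 ∧ x s ≠ 0 := by
  induction K with
  | zero => exact absurd (fun j hj => absurd hj (by omega)) h
  | succ K ih =>
    by_cases hx : x ∈ I m K 0
    · exact ⟨K, by omega, hx, fun h0 => h (mem_I_succ.2 ⟨hx, h0⟩)⟩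
    · obtain ⟨s, hs, h'⟩ := ih hx
      exact ⟨s, by omega, h'⟩

variable [∀ k, NeZero (m k)]

lemma rademacher_eq (k : ℕ) (x : G m) : rademacher m k x = ZMod.stdAddChar (x k) := by
  rw [ZMod.stdAddChar_apply, ZMod.toCircle_apply, rademacher]

lemma rademacher_add (k : ℕ) (x y : G m) :
    rademacher m k (x + y) = rademacher m k x * rademacher m k y := by
  simp only [rademacher_eq, Pi.add_apply, AddChar.map_add_eq_mul]

lemma norm_rademacher (k : ℕ) (x : G m) : ‖rademacher m k x‖ = 1 := by
  rw [rademacher_eq, ZMod.stdAddChar_apply]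
  exact Circle.norm_coe _

lemma rademacher_eq_one {k : ℕ} {x : G m} : rademacher m k x = 1 ↔ x k = 0 := by
  rw [rademacher_eq, ← AddChar.map_zero_eq_one (ZMod.stdAddChar (N := m k)),
    ZMod.injective_stdAddChar.eq_iff]

lemma rademacher_pow (k : ℕ) (x : G m) : rademacher m k x ^ m k = 1 := by
  rw [rademacher_eq, ← AddChar.map_nsmul_eq_pow]
  simp

lemma measurable_rademacher (k : ℕ) : Measurable (rademacher m k) := by
  have : rademacher m k = (fun a : ZMod (m k) => ZMod.stdAddChar a) ∘ fun x => x k := by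
    ext x; exact rademacher_eq k x
  rw [this]
  exact (measurable_of_finite _).comp (measurable_pi_apply k)

lemma psi_add (n : ℕ) (x y : G m) : psi m n (x + y) = psi m n x * psi m n y := by
  simp only [psi, rademacher_add, mul_pow, Finset.prod_mul_distrib]

lemma norm_psi (n : ℕ) (x : G m) : ‖psi m n x‖ = 1 := by
  simp [psi, norm_rademacher]

@[fun_prop]
lemma measurable_psi (n : ℕ) : Measurable (psi m n) := by
  unfold psi
  exact Finset.measurable_prod _ fun k _ => (measurable_rademacher k).pow_const _

lemma psi_of_mem_I (hm : ∀ k, 2 ≤ m k) {n s : ℕ} (h : n < M m s) {x : G m} (hx : x ∈ I m s 0) :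
    psi m n x = 1 := by
  refine Finset.prod_eq_one fun k _ => ?_
  rcases lt_or_ge k s with hk | hk
  · rw [rademacher_eq_one.2 (hx k hk), one_pow]
  · rw [digit_eq_zero_of_lt hm h hk, pow_zero]

/-- Two distinct multiples of `M_s` differ in a digit of some index `k ≥ s`, and the `k`-th unit
vector, which lies in `I_s`, detects that digit. -/
lemma exists_psi_ne (hm : ∀ k, 2 ≤ m k) {a b s : ℕ} (hab : a ≠ b) (ha : M m s ∣ a)
    (hb : M m s ∣ b) : ∃ e ∈ I m s 0, psi m a e ≠ psi m b e := by
  obtain ⟨k, hk⟩ : ∃ k, digit m a k ≠ digit m b k := by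
    by_contra! h
    have h1 := sum_digit m a (a + b)
    have h2 := sum_digit m b (a + b)
    have ha' : a < M m (a + b) := (lt_M m hm a).trans_le (M_le_M hm (by omega))
    have hb' : b < M m (a + b) := (lt_M m hm b).trans_le (M_le_M hm (by omega))
    rw [Nat.mod_eq_of_lt ha'] at h1
    rw [Nat.mod_eq_of_lt hb'] at h2
    simp only [h] at h1
    exact hab (h1.symm.trans h2)
  have hks : s ≤ k := by
    by_contra! h
    obtain ⟨c, rfl⟩ := ha
    obtain ⟨d, rfl⟩ := hb
    rw [mul_comm, mul_comm _ d, digit_mul_M_of_lt _ h, digit_mul_M_of_lt _ h] at hk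
    exact hk rfl
  have key : ∀ n, psi m n (Pi.single k 1) = ZMod.stdAddChar ((digit m n k : ℕ) : ZMod (m k)) := by
    intro n
    rw [psi_eq_prod hm (Nat.le_add_right n (k + 1)),
      Finset.prod_eq_single_of_mem k (by simp; omega)]
    · rw [rademacher_eq, ← AddChar.map_nsmul_eq_pow]
      simp
    · intro j _ hj
      rw [rademacher_eq_one.2 (by simp [hj]), one_pow]
  refine ⟨Pi.single k 1, fun j hj => by simp [show j ≠ k by omega], fun h => hk ?_⟩
  rw [key, key, ZMod.injective_stdAddChar.eq_iff, ZMod.natCast_eq_natCast_iff'] at h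
  have hlt : ∀ n, digit m n k < m k := fun n => Nat.mod_lt _ (by have := hm k; omega)
  rwa [Nat.mod_eq_of_lt (hlt a), Nat.mod_eq_of_lt (hlt b)] at h

/-- Distinct characters are orthogonal, also after multiplication by a function that is invariant
under the translations which separate them. -/
lemma integral_mul_psi_mul_conj_psi (hm : ∀ k, 2 ≤ m k) {a b s : ℕ} (hab : a ≠ b)
    (ha : M m s ∣ a) (hb : M m s ∣ b) {g : G m → ℂ} (hg : ∀ e ∈ I m s 0, ∀ x, g (e + x) = g x) :
    ∫ x, g x * (psi m a x * (starRingEnd ℂ) (psi m b x)) ∂haar m = 0 := by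
  obtain ⟨e, he, hne⟩ := exists_psi_ne hm hab ha hb
  -- Translation by `e` preserves the integral and also multiplies it by `ψ_a(e)` times the
  -- conjugate of `ψ_b(e)`, which is not `1`.
  have h := integral_add_left_eq_self (μ := haar m)
    (fun x => g x * (psi m a x * (starRingEnd ℂ) (psi m b x))) e
  have h' : ∀ x, g (e + x) * (psi m a (e + x) * (starRingEnd ℂ) (psi m b (e + x)))
      = (psi m a e * (starRingEnd ℂ) (psi m b e))
        * (g x * (psi m a x * (starRingEnd ℂ) (psi m b x))) := by
    intro x
    rw [hg e he, psi_add, psi_add, map_mul]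
    ring
  simp only [h'] at h
  rw [integral_const_mul] at h
  by_contra h0
  have h1 := mul_right_cancel₀ h0 (h.trans (one_mul _).symm)
  apply hne
  have h2 : (starRingEnd ℂ) (psi m b e) * psi m b e = 1 := by
    rw [mul_comm, Complex.mul_conj, Complex.normSq_eq_norm_sq, norm_psi]
    simp
  calc psi m a e = psi m a e * ((starRingEnd ℂ) (psi m b e) * psi m b e) := by rw [h2, mul_one]
    _ = psi m b e := by rw [← mul_assoc, h1, one_mul]

end Characters

/-! ### Dirichlet kernels: block structure, zeros and majorants. -/

section DirichletKernel

variable {m : ℕ → ℕ}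

/-- The Dirichlet kernels. -/
noncomputable def dirichlet (m : ℕ → ℕ) (j : ℕ) (x : G m) : ℂ := ∑ a ∈ Finset.range j, psi m a x

/-- The normalized indicator functions of the subgroups `I_s`. -/
noncomputable def delta (m : ℕ → ℕ) (s : ℕ) : G m → ℝ :=
  (I m s 0).indicator fun _ => (M m s : ℝ)

lemma delta_of_mem {s : ℕ} {x : G m} (h : x ∈ I m s 0) : delta m s x = M m s :=
  Set.indicator_of_mem h _

lemma delta_of_notMem {s : ℕ} {x : G m} (h : x ∉ I m s 0) : delta m s x = 0 :=
  Set.indicator_of_notMem h _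

lemma delta_nonneg (s : ℕ) (x : G m) : 0 ≤ delta m s x :=
  Set.indicator_nonneg (fun _ _ => Nat.cast_nonneg _) x

lemma dirichlet_mul_M_add (hm : ∀ k, 2 ≤ m k) (N s : ℕ) {l : ℕ} (hl : l ≤ M m s) (x : G m) :
    dirichlet m (N * M m s + l) x
      = dirichlet m (N * M m s) x + psi m (N * M m s) x * dirichlet m l x := by
  simp only [dirichlet, Finset.sum_range_add, Finset.mul_sum]
  congr 1
  exact Finset.sum_congr rfl fun a ha =>
    psi_mul_M_add hm N s a ((Finset.mem_range.1 ha).trans_le hl) x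

lemma dirichlet_mul_M (hm : ∀ k, 2 ≤ m k) (N s : ℕ) (x : G m) :
    dirichlet m (N * M m s) x
      = dirichlet m (M m s) x * ∑ b ∈ Finset.range N, psi m (b * M m s) x := by
  induction N with
  | zero => simp [dirichlet]
  | succ N ih =>
    rw [Nat.succ_mul, dirichlet_mul_M_add hm N s le_rfl, ih, Finset.sum_range_succ]
    ring

variable [∀ k, NeZero (m k)]

lemma norm_dirichlet_le (j : ℕ) (x : G m) : ‖dirichlet m j x‖ ≤ j := by
  refine (norm_sum_le _ _).trans ?_
  simp [norm_psi]

@[fun_prop]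
lemma measurable_dirichlet (j : ℕ) : Measurable (dirichlet m j) := by
  unfold dirichlet
  exact Finset.measurable_sum _ fun k _ => measurable_psi k

lemma dirichlet_of_mem_I (hm : ∀ k, 2 ≤ m k) {j s : ℕ} (h : j ≤ M m s) {x : G m}
    (hx : x ∈ I m s 0) : dirichlet m j x = j := by
  rw [dirichlet, Finset.sum_congr rfl fun a ha =>
    psi_of_mem_I hm ((Finset.mem_range.1 ha).trans_le h) hx]
  simp

/-- `D_{M_{s+1}}` contains the factor `∑_{b < m_s} r_s(x)^b`, a full geometric sum over a root of
unity different from `1`. -/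
lemma dirichlet_mul_M_eq_zero (hm : ∀ k, 2 ≤ m k) (N : ℕ) {s : ℕ} {x : G m} (hxs : x s ≠ 0) :
    dirichlet m (N * M m (s + 1)) x = 0 := by
  have h : dirichlet m (M m (s + 1)) x = 0 := by
    rw [M, dirichlet_mul_M hm, Finset.sum_congr rfl fun b hb =>
      psi_mul_M_of_lt hm (Finset.mem_range.1 hb) x,
      geom_sum_eq (fun h => hxs (rademacher_eq_one.1 h)), rademacher_pow]
    simp
  rw [dirichlet_mul_M hm, h, zero_mul]

lemma dirichlet_M (hm : ∀ k, 2 ≤ m k) (K : ℕ) (x : G m) :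
    dirichlet m (M m K) x = delta m K x := by
  by_cases hx : x ∈ I m K 0
  · rw [delta_of_mem hx, dirichlet_of_mem_I hm le_rfl hx]
    simp
  · obtain ⟨s, hs, -, hxs⟩ := exists_mem_I_ne_zero hx
    obtain ⟨c, hc⟩ := M_dvd_M (m := m) (Nat.succ_le_of_lt hs)
    rw [delta_of_notMem hx, hc, mul_comm, dirichlet_mul_M_eq_zero hm _ hxs]
    simp

/-- The majorant `∑_{s ≤ r ≤ K} M_r 1_{I_r}` of the Dirichlet kernels on `I_s`. -/
noncomputable def majorant (m : ℕ → ℕ) (s K : ℕ) (x : G m) : ℝ :=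
  ∑ r ∈ Finset.Icc s K, delta m r x

omit [∀ k, NeZero (m k)] in
lemma majorant_nonneg (s K : ℕ) (x : G m) : 0 ≤ majorant m s K x :=
  Finset.sum_nonneg fun r _ => delta_nonneg r x

omit [∀ k, NeZero (m k)] in
lemma le_majorant {s K : ℕ} (h : s ≤ K) {x : G m} (hx : x ∈ I m s 0) :
    (M m s : ℝ) ≤ majorant m s K x := by
  rw [← delta_of_mem hx]
  exact Finset.single_le_sum (f := fun r => delta m r x) (fun r _ => delta_nonneg r x)
    (Finset.mem_Icc.2 ⟨le_rfl, h⟩)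

omit [∀ k, NeZero (m k)] in
lemma majorant_eq {s K : ℕ} (h : s ≤ K) {x : G m} (hx : x ∈ I m s 0) (hxs : x s ≠ 0) :
    majorant m s K x = M m s := by
  rw [majorant, Finset.sum_eq_single_of_mem s (Finset.mem_Icc.2 ⟨le_rfl, h⟩), delta_of_mem hx]
  intro r hr hrs
  exact delta_of_notMem fun hr' => hxs (hr' s (by simp at hr; omega))

lemma norm_dirichlet_le_majorant (hm : ∀ k, 2 ≤ m k) {B : ℕ} (hB : ∀ k, m k ≤ B) {s K j : ℕ}
    (hs : s ≤ K) (hj : j ≤ M m K) {x : G m} (hx : x ∈ I m s 0) :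
    ‖dirichlet m j x‖ ≤ (B + 1) * majorant m s K x := by
  -- Induction on `K` peels off the leading part `ν M_K` of the index: its kernel is `D_{M_K} =
  -- delta m K` times `ν ≤ B` unimodular terms.
  have key : ∀ j ≤ M m K, ‖dirichlet m j x‖
      ≤ M m s + ∑ r ∈ Finset.Ico s K, B * delta m r x := by
    clear hj j
    induction K, hs using Nat.le_induction with
    | base =>
      intro j hj
      rw [dirichlet_of_mem_I hm hj hx]
      simpa using hj
    | succ K hs ih =>
      intro j hj
      rw [Finset.sum_Ico_succ_top hs]
      have hl : j % M m K < M m K := Nat.mod_lt _ (M_pos hm K)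
      have hν : j / M m K ≤ B :=
        (Nat.div_le_of_le_mul (by rw [mul_comm]; exact hj)).trans (hB K)
      have h1 : ‖dirichlet m (j / M m K * M m K) x‖ ≤ B * delta m K x := by
        rw [dirichlet_mul_M hm, dirichlet_M hm, norm_mul, mul_comm]
        simp only [Complex.norm_real, Real.norm_of_nonneg (delta_nonneg K x)]
        refine mul_le_mul_of_nonneg_right ?_ (delta_nonneg K x)
        refine (norm_sum_le _ _).trans ?_
        simpa [norm_psi] using hν
      have h2 := ih _ hl.le
      have e : j = j / M m K * M m K + j % M m K := (Nat.div_add_mod' j _).symm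
      calc ‖dirichlet m j x‖
          = ‖dirichlet m (j / M m K * M m K) x
              + psi m (j / M m K * M m K) x * dirichlet m (j % M m K) x‖ := by
            rw [← dirichlet_mul_M_add hm _ _ hl.le, ← e]
        _ ≤ B * delta m K x + ‖dirichlet m (j % M m K) x‖ := by
            refine (norm_add_le _ _).trans ?_
            rw [norm_mul, norm_psi, one_mul]
            gcongr
        _ ≤ _ := by linarith
  refine (key j hj).trans ?_
  rw [add_mul, one_mul, add_comm, majorant, Finset.mul_sum]
  refine add_le_add ?_ (le_majorant hs hx)
  refine Finset.sum_le_sum_of_subset_of_nonneg ?_ fun r _ _ =>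
    mul_nonneg (Nat.cast_nonneg _) (delta_nonneg r x)
  intro r hr
  simp at hr ⊢
  omega

/-- On `I_s` the Dirichlet kernels are affine in each block of indices of length `M_s`. -/
lemma dirichlet_block (hm : ∀ k, 2 ≤ m k) (N : ℕ) {s l : ℕ} (hl : l ≤ M m s) {x : G m}
    (hx : x ∈ I m s 0) :
    dirichlet m (N * M m s + l) x = dirichlet m (N * M m s) x + psi m (N * M m s) x * l := by
  rw [dirichlet_mul_M_add hm N s hl, dirichlet_of_mem_I hm hl hx]

lemma norm_dirichlet_sub_le (hm : ∀ k, 2 ≤ m k) (N : ℕ) {s l l' : ℕ} (hl : l ≤ M m s)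
    (hl' : l' ≤ l) {x : G m} (hx : x ∈ I m s 0) :
    ‖dirichlet m (N * M m s + l') x - dirichlet m (N * M m s + l) x‖ ≤ (l : ℝ) - l' := by
  rw [dirichlet_block hm N hl hx, dirichlet_block hm N (hl'.trans hl) hx, add_sub_add_left_eq_sub,
    ← mul_sub, norm_mul, norm_psi, one_mul, norm_sub_rev, ← Nat.cast_sub hl', Complex.norm_natCast,
    Nat.cast_sub hl']

end DirichletKernel

end Vilenkin

namespace Vilenkin

/-! ### Pointwise bounds for the Cesàro kernel, scale by scale. -/

section CesaroKernelPointwise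

variable {m : ℕ → ℕ} {α : ℝ}

/-- The Cesàro weighted sum of the quadratic Dirichlet kernels. -/
noncomputable def cesaroKernel (m : ℕ → ℕ) (α : ℝ) (n : ℕ) (x y : G m) : ℂ :=
  ∑ i ∈ Finset.range (n + 1),
    (cesaroA (-α - 1) i : ℂ) * (dirichlet m (n - i) x * dirichlet m (n - i) y)

/-- The size of the Cesàro kernel at the scale `s`. -/
noncomputable def scaleBound (m : ℕ → ℕ) (α : ℝ) (n s : ℕ) : ℝ :=
  (if digit m n s = 0 then 0 else (((n % M m s : ℕ) : ℝ) + 1) ^ (-α)) + (M m s : ℝ) ^ (-α)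

lemma norm_sum_cesaroA_mul_le {ι : Type*} (S : Finset ι) (w : ι → ℝ) (P : ι → ℂ) (b : ι → ℝ)
    (h : ∀ i ∈ S, ‖P i‖ ≤ b i) : ‖∑ i ∈ S, (w i : ℂ) * P i‖ ≤ ∑ i ∈ S, |w i| * b i := by
  refine (norm_sum_le _ _).trans (Finset.sum_le_sum fun i hi => ?_)
  rw [norm_mul, Complex.norm_real, Real.norm_eq_abs]
  exact mul_le_mul_of_nonneg_left (h i hi) (abs_nonneg _)

/-- The cancellation in the weights is used by freezing `P` at `0`: the weights sum to `A_q^{-α}`,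
much less than their absolute sum, and the error carries a factor `i`. -/
lemma norm_sum_cesaroA_mul_le_of_lipschitz (h0 : 0 < α) (h1 : α < 1) (q : ℕ) (P : ℕ → ℂ) (D : ℝ)
    (h : ∀ i ≤ q, ‖P i - P 0‖ ≤ D * i) :
    ‖∑ i ∈ Finset.range (q + 1), (cesaroA (-α - 1) i : ℂ) * P i‖
      ≤ ((q : ℝ) + 1) ^ (-α) * ‖P 0‖ + D * ((q : ℝ) ^ (1 - α) / (1 - α)) := by
  have e : ∑ i ∈ Finset.range (q + 1), (cesaroA (-α - 1) i : ℂ) * P i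
      = (cesaroA (-α) q : ℂ) * P 0
        + ∑ i ∈ Finset.range (q + 1), (cesaroA (-α - 1) i : ℂ) * (P i - P 0) := by
    rw [← sum_cesaroA_sub_one]
    push_cast
    rw [Finset.sum_mul, ← Finset.sum_add_distrib]
    exact Finset.sum_congr rfl fun i _ => by ring
  rw [e]
  refine (norm_add_le _ _).trans (add_le_add ?_ ?_)
  · rw [norm_mul, Complex.norm_real, Real.norm_of_nonneg (cesaroA_neg_pos h1 q).le]
    exact mul_le_mul_of_nonneg_right (cesaroA_neg_le h0 h1 q) (norm_nonneg _)
  -- A negative `D` is compatible with the hypothesis only when `q = 0`, where both sides vanish.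
  · rcases lt_or_ge D 0 with hD | hD
    · have hq0 : q = 0 := by
        by_contra hq
        have := (norm_nonneg _).trans (h q le_rfl)
        have hq' : (0 : ℝ) < q := by positivity
        nlinarith
      subst hq0
      have h1' : (1 : ℝ) - α ≠ 0 := by linarith
      simp [Real.zero_rpow h1']
    refine (norm_sum_cesaroA_mul_le _ _ _ (fun i : ℕ => D * i) fun i hi =>
      h i (by simp at hi; omega)).trans ?_
    calc _ = D * ∑ i ∈ Finset.range (q + 1), |cesaroA (-α - 1) i| * i := by
          rw [Finset.mul_sum]
          exact Finset.sum_congr rfl fun i _ => by ring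
      _ ≤ _ := mul_le_mul_of_nonneg_left (sum_abs_cesaroA_mul_le h0 h1 q) hD

variable [∀ k, NeZero (m k)]

/-- Since the digit `n_s` vanishes, `n - n % M_s` is a multiple of `M_{s+1}`, and the Dirichlet
kernel of that index vanishes at `x`. In the blocks of length `M_s` on either side of it the kernel
is affine in its index with unimodular slope. -/
lemma norm_dirichlet_le_abs_sub (hm : ∀ k, 2 ≤ m k) {n s i : ℕ} (hd : digit m n s = 0) {x : G m}
    (hx : x ∈ I m s 0) (hxs : x s ≠ 0) (hi : i ≤ n) (hi' : i ≤ n % M m s + M m s) :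
    ‖dirichlet m (n - i) x‖ ≤ |((n % M m s : ℕ) : ℝ) - i| := by
  have hn : n = n / M m s * M m s + n % M m s := (Nat.div_add_mod' n _).symm
  have hq : n % M m s < M m s := Nat.mod_lt _ (M_pos hm s)
  obtain ⟨N', hN'⟩ := Nat.dvd_of_mod_eq_zero (show n / M m s % m s = 0 from hd)
  have hz : dirichlet m (n / M m s * M m s) x = 0 := by
    have : n / M m s * M m s = N' * M m (s + 1) := by rw [hN', M]; ring
    rw [this, dirichlet_mul_M_eq_zero hm _ hxs]
  rcases le_or_gt i (n % M m s) with h | h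
  · have e : n - i = n / M m s * M m s + (n % M m s - i) := by omega
    rw [e, dirichlet_block hm _ (by omega) hx, hz, zero_add, norm_mul, norm_psi, one_mul,
      Complex.norm_natCast, Nat.cast_sub h]
    exact le_abs_self _
  -- Here `n - i` lies in the block just below the zero; such a block exists because `n % M_s < i ≤
  -- n`.
  · obtain ⟨N, hN⟩ : ∃ N, n / M m s = N + 1 := by
      refine ⟨n / M m s - 1, ?_⟩
      rcases Nat.eq_zero_or_pos (n / M m s) with h0 | h0
      · rw [h0] at hn; omega
      · omega
    rw [hN, Nat.succ_mul] at hz hn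
    have e : n - i = N * M m s + (M m s - (i - n % M m s)) := by omega
    have h2 := norm_dirichlet_sub_le hm N (l := M m s) (l' := M m s - (i - n % M m s)) le_rfl
      (by omega) hx
    rw [hz, sub_zero, ← e] at h2
    refine h2.trans ?_
    rw [Nat.cast_sub (by omega), Nat.cast_sub h.le, abs_sub_comm]
    refine le_trans (le_of_eq ?_) (le_abs_self _)
    ring

lemma rpow_one_sub_le_of_le {a b : ℕ} (hb : 0 < b) (h : a ≤ b) (h1 : α < 1) :
    (a : ℝ) ^ (1 - α) ≤ b * (b : ℝ) ^ (-α) := by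
  have hb' : (0 : ℝ) < b := by exact_mod_cast hb
  calc (a : ℝ) ^ (1 - α) ≤ (b : ℝ) ^ (1 - α) := by
        have : (0 : ℝ) ≤ 1 - α := by linarith
        gcongr
    _ = _ := by rw [sub_eq_add_neg, Real.rpow_add hb', Real.rpow_one]

/-- With `q = n % M_s`, the indices `n - i`, `i ≤ q`, stay in one block of length `M_s`, where both
Dirichlet kernels are affine; for `i > q` the total weight is at most `(q+1)^{-α}`. The second bound
keeps `‖D_n(x)‖`, because it can be improved when the digit `n_s` vanishes. -/
lemma norm_cesaroKernel_le_and_norm_first_block_le (h0 : 0 < α) (h1 : α < 1) (hm : ∀ k, 2 ≤ m k) {B : ℕ}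
    {s n : ℕ} {L : ℝ} {x y : G m} (hx : x ∈ I m s 0) (hy : y ∈ I m s 0) (hL : (M m s : ℝ) ≤ L)
    (hxD : ∀ j ≤ n, ‖dirichlet m j x‖ ≤ (B + 1) * M m s) (hyD : ∀ j ≤ n, ‖dirichlet m j y‖ ≤ L) :
    ‖cesaroKernel m α n x y‖ ≤ (2 * (B + 1) + (B + 2) / (1 - α)) * M m s * L *
      ((((n % M m s : ℕ) : ℝ) + 1) ^ (-α) + (M m s : ℝ) ^ (-α)) ∧
    ‖∑ i ∈ Finset.range (n % M m s + 1),
      (cesaroA (-α - 1) i : ℂ) * (dirichlet m (n - i) x * dirichlet m (n - i) y)‖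
        ≤ (((n % M m s : ℕ) : ℝ) + 1) ^ (-α) * (‖dirichlet m n x‖ * L)
          + (B + 2) / (1 - α) * M m s * L * (M m s : ℝ) ^ (-α) := by
  have hα : (0 : ℝ) < 1 - α := by linarith
  have hn : n = n / M m s * M m s + n % M m s := (Nat.div_add_mod' n _).symm
  have hq : n % M m s < M m s := Nat.mod_lt _ (M_pos hm s)
  have hqn : n % M m s ≤ n := Nat.mod_le _ _
  set q := n % M m s with hqdef
  have hM0 : (0 : ℝ) ≤ M m s := Nat.cast_nonneg _
  have hL0 : 0 ≤ L := hM0.trans hL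
  have first : ‖∑ i ∈ Finset.range (q + 1),
      (cesaroA (-α - 1) i : ℂ) * (dirichlet m (n - i) x * dirichlet m (n - i) y)‖
        ≤ ((q : ℝ) + 1) ^ (-α) * (‖dirichlet m n x‖ * L)
          + (B + 2) / (1 - α) * M m s * L * (M m s : ℝ) ^ (-α) := by
    refine (norm_sum_cesaroA_mul_le_of_lipschitz h0 h1 q
      (fun i => dirichlet m (n - i) x * dirichlet m (n - i) y) ((B + 2) * L) ?_).trans
      (add_le_add ?_ ?_)
    · intro i hi
      have e : n - i = n / M m s * M m s + (q - i) := by omega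
      have hX := norm_dirichlet_sub_le hm (n / M m s) hq.le (Nat.sub_le q i) hx
      have hY := norm_dirichlet_sub_le hm (n / M m s) hq.le (Nat.sub_le q i) hy
      rw [← e, ← hn, Nat.cast_sub hi, sub_sub_cancel] at hX hY
      simp only [Nat.sub_zero]
      calc _ = ‖(dirichlet m (n - i) x - dirichlet m n x) * dirichlet m (n - i) y
              + dirichlet m n x * (dirichlet m (n - i) y - dirichlet m n y)‖ := by
            congr 1; ring
        _ ≤ i * L + ((B + 1) * M m s) * i := by
            refine (norm_add_le _ _).trans ?_
            rw [norm_mul, norm_mul]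
            gcongr
            · exact hyD _ (Nat.sub_le _ _)
            · exact hxD _ le_rfl
        _ ≤ i * L + ((B + 1) * L) * i := by gcongr
        _ = _ := by ring
    · simp only [Nat.sub_zero]
      rw [norm_mul]
      gcongr
      exact hyD n le_rfl
    · calc _ ≤ ((B + 2) * L) * ((M m s * (M m s : ℝ) ^ (-α)) / (1 - α)) := by
            gcongr
            exact rpow_one_sub_le_of_le (M_pos hm s) hq.le h1
        _ = _ := by ring
  refine ⟨?_, first⟩
  have rest : ‖∑ i ∈ Finset.Ico (q + 1) (n + 1),
      (cesaroA (-α - 1) i : ℂ) * (dirichlet m (n - i) x * dirichlet m (n - i) y)‖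
      ≤ ((q : ℝ) + 1) ^ (-α) * (((B + 1) * M m s) * L) := by
    refine (norm_sum_cesaroA_mul_le _ _ _ (fun _ => ((B + 1) * M m s) * L) fun i _ => ?_).trans ?_
    · rw [norm_mul]
      exact mul_le_mul (hxD _ (Nat.sub_le _ _)) (hyD _ (Nat.sub_le _ _)) (norm_nonneg _)
        (by positivity)
    · rw [← Finset.sum_mul]
      exact mul_le_mul_of_nonneg_right (sum_Ico_abs_cesaroA_le h0 h1 q _) (by positivity)
  rw [cesaroKernel, ← Finset.sum_range_add_sum_Ico _ (show q + 1 ≤ n + 1 by omega)]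
  have hP : ((q : ℝ) + 1) ^ (-α) * (‖dirichlet m n x‖ * L)
      ≤ ((q : ℝ) + 1) ^ (-α) * (((B + 1) * M m s) * L) := by
    gcongr
    exact hxD n le_rfl
  have hX : 0 ≤ ((q : ℝ) + 1) ^ (-α) * ((B + 2) / (1 - α) * M m s * L) := by positivity
  have hY : 0 ≤ (M m s : ℝ) ^ (-α) * (2 * (B + 1) * M m s * L) := by positivity
  refine (norm_add_le _ _).trans ?_
  linarith

lemma norm_cesaroKernel_le (h0 : 0 < α) (h1 : α < 1) (hm : ∀ k, 2 ≤ m k) {B : ℕ}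
    (hB : ∀ k, m k ≤ B) {s K n : ℕ} (hs : s ≤ K) (hn : n ≤ M m K) {x y : G m}
    (hx : x ∈ I m s 0) (hxs : x s ≠ 0) (hy : y ∈ I m s 0) :
    ‖cesaroKernel m α n x y‖ ≤ (2 * (B + 1) + (B + 4) / (1 - α)) * (B + 1) *
      (scaleBound m α n s * (delta m s x * majorant m s K y)) := by
  have hα : (0 : ℝ) < 1 - α := by linarith
  set L : ℝ := (B + 1) * majorant m s K y with hLdef
  have hyD : ∀ j ≤ n, ‖dirichlet m j y‖ ≤ L := fun j hj =>
    norm_dirichlet_le_majorant hm hB hs (hj.trans hn) hy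
  have hxD : ∀ j ≤ n, ‖dirichlet m j x‖ ≤ (B + 1) * M m s := fun j hj =>
    (norm_dirichlet_le_majorant hm hB hs (hj.trans hn) hx).trans_eq (by
      rw [majorant_eq hs hx hxs])
  have hM0 : (0 : ℝ) ≤ M m s := Nat.cast_nonneg _
  have hB0 : (0 : ℝ) ≤ B := Nat.cast_nonneg _
  have hL : (M m s : ℝ) ≤ L := by
    have := le_majorant hs hy
    have := mul_nonneg hB0 (majorant_nonneg s K y)
    linarith
  have hL0 : 0 ≤ L := hM0.trans hL
  obtain ⟨main, first⟩ := norm_cesaroKernel_le_and_norm_first_block_le h0 h1 hm hx hy hL hxD hyD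
  have e : (2 * ((B : ℝ) + 1) + (B + 4) / (1 - α)) * (B + 1) *
      (scaleBound m α n s * (delta m s x * majorant m s K y))
      = (2 * (B + 1) + (B + 4) / (1 - α)) * M m s * L * scaleBound m α n s := by
    rw [delta_of_mem hx]; ring
  rw [e, scaleBound]
  split_ifs with hd
  · have hq : n % M m s < M m s := Nat.mod_lt _ (M_pos hm s)
    have hqn : n % M m s ≤ n := Nat.mod_le _ _
    set q := n % M m s with hqdef
    have hDn := norm_dirichlet_le_abs_sub hm hd hx hxs (Nat.zero_le n) (Nat.zero_le _)
    simp only [Nat.sub_zero, Nat.cast_zero, sub_zero, Nat.abs_cast, ← hqdef] at hDn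
    -- The zero of the kernel at index `n - q` gives `‖D_n(x)‖ ≤ q`, which turns `(q+1)^{-α}` into
    -- `M_s^{1-α}`.
    have t1 : ((q : ℝ) + 1) ^ (-α) * (‖dirichlet m n x‖ * L)
        ≤ M m s * L * (M m s : ℝ) ^ (-α) := by
      have hq1 : (0 : ℝ) < (q : ℝ) + 1 := by positivity
      have := rpow_one_sub_le_of_le (α := α) (M_pos hm s) (show q + 1 ≤ M m s from hq) h1
      rw [sub_eq_add_neg, Nat.cast_succ, Real.rpow_add hq1, Real.rpow_one] at this
      calc _ ≤ ((q : ℝ) + 1) ^ (-α) * (((q : ℝ) + 1) * L) := by gcongr; linarith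
        _ = ((q + 1) * ((q : ℝ) + 1) ^ (-α)) * L := by ring
        _ ≤ (M m s * (M m s : ℝ) ^ (-α)) * L := by gcongr
        _ = _ := by ring
    have rest : ‖∑ i ∈ Finset.Ico (q + 1) (n + 1),
        (cesaroA (-α - 1) i : ℂ) * (dirichlet m (n - i) x * dirichlet m (n - i) y)‖
        ≤ (2 / (1 - α) + (B + 1)) * M m s * L * (M m s : ℝ) ^ (-α) := by
      -- Up to `q + M_s` the kernel at `x` is at most `i`, and `∑ i |A_i^{-α-1}|` is `O(M_s^{1-α})`;
      -- beyond that the tail of the weights is at most `M_s^{-α}`.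
      rw [← Finset.sum_filter_add_sum_filter_not _ (· < q + M m s + 1)]
      refine (norm_add_le _ _).trans ?_
      have a1 : ‖∑ i ∈ Finset.Ico (q + 1) (n + 1) with i < q + M m s + 1,
          (cesaroA (-α - 1) i : ℂ) * (dirichlet m (n - i) x * dirichlet m (n - i) y)‖
          ≤ 2 / (1 - α) * M m s * L * (M m s : ℝ) ^ (-α) := by
        refine (norm_sum_cesaroA_mul_le _ _ _ (fun i : ℕ => i * L) fun i hi => ?_).trans ?_
        · simp only [Finset.mem_filter, Finset.mem_Ico] at hi
          have h3 := norm_dirichlet_le_abs_sub hm hd hx hxs (show i ≤ n by omega)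
            (show i ≤ q + M m s by omega)
          rw [norm_mul]
          refine mul_le_mul (h3.trans ?_) (hyD _ (Nat.sub_le _ _)) (norm_nonneg _) (by positivity)
          have h4 : (q : ℝ) ≤ i := by exact_mod_cast (show q ≤ i by omega)
          have h5 := q.cast_nonneg (α := ℝ)
          rw [abs_of_nonpos (by linarith)]
          linarith
        · calc _ = L * ∑ i ∈ Finset.Ico (q + 1) (n + 1) with i < q + M m s + 1,
                  |cesaroA (-α - 1) i| * i := by
                rw [Finset.mul_sum]
                exact Finset.sum_congr rfl fun i _ => by ring
            _ ≤ L * ∑ i ∈ Finset.range (q + M m s + 1), |cesaroA (-α - 1) i| * i := by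
                gcongr
                intro i hi
                simp at hi ⊢
                omega
            _ ≤ L * (((q + M m s : ℕ) : ℝ) ^ (1 - α) / (1 - α)) := by
                gcongr
                exact sum_abs_cesaroA_mul_le h0 h1 _
            _ ≤ L * ((2 * (M m s * (M m s : ℝ) ^ (-α))) / (1 - α)) := by
                gcongr
                have h2M := rpow_one_sub_le_of_le (α := α) (show 0 < 2 * M m s by omega)
                  (show q + M m s ≤ 2 * M m s by omega) h1
                refine h2M.trans ?_
                push_cast
                rw [mul_assoc]
                have hMs : (0 : ℝ) < M m s := by exact_mod_cast M_pos hm s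
                have : (2 * (M m s : ℝ)) ^ (-α) ≤ (M m s : ℝ) ^ (-α) :=
                  Real.rpow_le_rpow_of_nonpos hMs (by linarith) (by linarith)
                gcongr
            _ = _ := by ring
      have a2 : ‖∑ i ∈ Finset.Ico (q + 1) (n + 1) with ¬ i < q + M m s + 1,
          (cesaroA (-α - 1) i : ℂ) * (dirichlet m (n - i) x * dirichlet m (n - i) y)‖
          ≤ (B + 1) * M m s * L * (M m s : ℝ) ^ (-α) := by
        refine (norm_sum_cesaroA_mul_le _ _ _ (fun _ => ((B + 1) * M m s) * L)
          fun i _ => ?_).trans ?_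
        · rw [norm_mul]
          exact mul_le_mul (hxD _ (Nat.sub_le _ _)) (hyD _ (Nat.sub_le _ _)) (norm_nonneg _)
            (by positivity)
        · rw [← Finset.sum_mul, mul_comm]
          refine mul_le_mul_of_nonneg_left ?_ (by positivity)
          calc _ ≤ ∑ i ∈ Finset.Ico (q + M m s + 1) (n + 1), |cesaroA (-α - 1) i| := by
                refine Finset.sum_le_sum_of_subset_of_nonneg ?_ fun _ _ _ => abs_nonneg _
                intro i hi
                simp at hi ⊢
                omega
            _ ≤ _ := sum_Ico_abs_cesaroA_le h0 h1 _ _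
            _ ≤ _ := by
                have hMs : (0 : ℝ) < M m s := by exact_mod_cast M_pos hm s
                refine Real.rpow_le_rpow_of_nonpos hMs ?_ (by linarith)
                push_cast
                have := q.cast_nonneg (α := ℝ)
                linarith
      linarith
    rw [cesaroKernel, ← Finset.sum_range_add_sum_Ico _ (show q + 1 ≤ n + 1 by omega)]
    refine (norm_add_le _ _).trans ((add_le_add first rest).trans ?_)
    have hX : 0 ≤ B * (M m s * L * (M m s : ℝ) ^ (-α)) := by positivity
    have e2 : (2 * ((B : ℝ) + 1) + (B + 4) / (1 - α)) * M m s * L * (0 + (M m s : ℝ) ^ (-α))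
      = (2 + B) * (M m s * L * (M m s : ℝ) ^ (-α)) + B * (M m s * L * (M m s : ℝ) ^ (-α))
        + (B + 2) / (1 - α) * M m s * L * (M m s : ℝ) ^ (-α)
        + 2 / (1 - α) * M m s * L * (M m s : ℝ) ^ (-α) := by ring
    rw [e2]
    linarith
  · refine main.trans ?_
    gcongr
    linarith

omit [∀ k, NeZero (m k)] in
-- Each nonzero digit `n_s` at least doubles `n % M_s + 1` on passing from `s` to `s + 1`, so the
-- nonzero terms decay geometrically. The zero digits must be left out, since `n % M_s` stays
-- constant along them.
lemma sum_scaleBound_le (h0 : 0 < α) (hm : ∀ k, 2 ≤ m k) (n K : ℕ) :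
    ∑ s ∈ Finset.range K, scaleBound m α n s ≤ 2 / (1 - 2 ^ (-α)) := by
  have h2 : (2 : ℝ) ^ (-α) < 1 := Real.rpow_lt_one_of_one_lt_of_neg (by norm_num) (by linarith)
  have h2' : (0 : ℝ) < 2 ^ (-α) := by positivity
  set t : ℝ := 2 ^ (-α) with ht
  have ht' : 0 < 1 - t := by linarith
  have hMt : ∀ s, (M m s : ℝ) ^ (-α) ≤ t ^ s := by
    intro s
    induction s with
    | zero => simp [M]
    | succ s ih =>
      rw [M, Nat.cast_mul, Real.mul_rpow (Nat.cast_nonneg _) (Nat.cast_nonneg _), pow_succ,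
        mul_comm]
      have : ((m s : ℕ) : ℝ) ^ (-α) ≤ t :=
        Real.rpow_le_rpow_of_nonpos (by norm_num) (by exact_mod_cast hm s) (by linarith)
      gcongr
  -- The subtracted power serves as a potential: at a nonzero digit it falls by at least `1 - t`
  -- times the new term, at a zero digit it is unchanged.
  have key : ∀ K, (1 - t) * ∑ s ∈ Finset.range K,
      (if digit m n s = 0 then 0 else (((n % M m s : ℕ) : ℝ) + 1) ^ (-α))
      ≤ 1 - (((n % M m K : ℕ) : ℝ) + 1) ^ (-α) := by
    intro K
    induction K with
    | zero => simp [M, Nat.mod_one]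
    | succ K ih =>
      rw [Finset.sum_range_succ, mul_add]
      have hmod : n % M m (K + 1) = n % M m K + M m K * digit m n K := by
        rw [M, mul_comm (m K), Nat.mod_mul, digit]
      have hlt : n % M m K < M m K := Nat.mod_lt _ (M_pos hm K)
      split_ifs with hd
      · rw [hmod, hd]
        simpa using ih
      · have hle : M m K ≤ M m K * digit m n K := Nat.le_mul_of_pos_right _ (by omega)
        have h3 : 2 * (((n % M m K : ℕ) : ℝ) + 1) ≤ ((n % M m (K + 1) : ℕ) : ℝ) + 1 := by
          exact_mod_cast (show 2 * (n % M m K + 1) ≤ n % M m (K + 1) + 1 by omega)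
        have h4 : (((n % M m (K + 1) : ℕ) : ℝ) + 1) ^ (-α)
            ≤ t * (((n % M m K : ℕ) : ℝ) + 1) ^ (-α) := by
          rw [ht, ← Real.mul_rpow (by norm_num) (by positivity)]
          exact Real.rpow_le_rpow_of_nonpos (by positivity) h3 (by linarith)
        linarith
  simp only [scaleBound]
  rw [Finset.sum_add_distrib, le_div_iff₀ ht']
  have h5 := key K
  have h6 : (0 : ℝ) ≤ (((n % M m K : ℕ) : ℝ) + 1) ^ (-α) := by positivity
  have h7 : (1 - t) * ∑ s ∈ Finset.range K, (M m s : ℝ) ^ (-α) ≤ 1 := by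
    calc _ ≤ (1 - t) * ∑ s ∈ Finset.range K, t ^ s := by
          gcongr with s hs
          exact hMt s
      _ = 1 - t ^ K := mul_neg_geom_sum t K
      _ ≤ 1 := by have := pow_pos h2' K; linarith
  nlinarith

end CesaroKernelPointwise

end Vilenkin

namespace Vilenkin

/-! ### Integration of the pointwise bounds: the Cesàro kernel in `L^1`. -/

section KernelIntegrals

variable {m : ℕ → ℕ}

lemma exists_scale {K : ℕ} {x y : G m} (h : ¬ (x ∈ I m K 0 ∧ y ∈ I m K 0)) :
    ∃ s < K, x ∈ I m s 0 ∧ y ∈ I m s 0 ∧ (x s ≠ 0 ∨ y s ≠ 0) := by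
  induction K with
  | zero => exact absurd ⟨fun j hj => absurd hj (by omega), fun j hj => absurd hj (by omega)⟩ h
  | succ K ih =>
    by_cases hx : x ∈ I m K 0 ∧ y ∈ I m K 0
    · refine ⟨K, by omega, hx.1, hx.2, ?_⟩
      by_contra! h0
      exact h ⟨mem_I_succ.2 ⟨hx.1, h0.1⟩, mem_I_succ.2 ⟨hx.2, h0.2⟩⟩
    · obtain ⟨s, hs, h'⟩ := ih hx
      exact ⟨s, by omega, h'⟩

@[fun_prop]
lemma measurable_delta (s : ℕ) : Measurable (delta m s) :=
  measurable_const.indicator (measurableSet_I s 0)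

@[fun_prop]
lemma measurable_majorant (s K : ℕ) : Measurable (majorant m s K) := by
  unfold majorant
  fun_prop

lemma cesaroKernel_comm (α : ℝ) (n : ℕ) (x y : G m) :
    cesaroKernel m α n x y = cesaroKernel m α n y x := by
  simp only [cesaroKernel, mul_comm (dirichlet m _ x)]

/-- The weighted sum of quadratic Dirichlet kernels with weights `c`. -/
noncomputable def quadKernel (m : ℕ → ℕ) (c : ℕ → ℝ) (J : ℕ) (x y : G m) : ℂ :=
  ∑ j ∈ Finset.range J, (c j : ℂ) * (dirichlet m j x * dirichlet m j y)

lemma quadKernel_comm (c : ℕ → ℝ) (J : ℕ) (x y : G m) :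
    quadKernel m c J x y = quadKernel m c J y x := by
  simp only [quadKernel, mul_comm (dirichlet m _ x)]

lemma cesaroKernel_eq_quadKernel (α : ℝ) (n : ℕ) (x y : G m) :
    cesaroKernel m α n x y
      = quadKernel m (fun j => cesaroA (-α - 1) (n - j)) (n + 1) x y := by
  rw [cesaroKernel, quadKernel, ← Finset.sum_range_reflect]
  refine Finset.sum_congr rfl fun j hj => ?_
  have hj' : j ≤ n := by simp at hj; omega
  have e1 : n + 1 - 1 - j = n - j := by omega
  have e2 : n - (n - j) = j := by omega
  rw [e1, e2]

variable [∀ k, NeZero (m k)]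

@[fun_prop]
lemma measurable_quadKernel (c : ℕ → ℝ) (J : ℕ) :
    Measurable fun z : G m × G m => quadKernel m c J z.1 z.2 := by
  unfold quadKernel
  fun_prop

lemma integrable_of_measurable_of_norm_le {X E : Type*} [MeasurableSpace X] [NormedAddCommGroup E]
    [MeasurableSpace E] [BorelSpace E] [SecondCountableTopology E] {μ : Measure X}
    [IsFiniteMeasure μ] {f : X → E} (hf : Measurable f) {C : ℝ}
    (h : ∀ x, ‖f x‖ ≤ C) : Integrable f μ :=
  Integrable.of_bound hf.aestronglyMeasurable C (Filter.Eventually.of_forall h)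

omit [∀ k, NeZero (m k)] in
lemma norm_delta_le (s : ℕ) (x : G m) : ‖delta m s x‖ ≤ M m s := by
  rw [Real.norm_of_nonneg (delta_nonneg s x)]
  exact Set.indicator_apply_le' (fun _ => le_rfl) fun _ => Nat.cast_nonneg _

lemma integrable_delta (s : ℕ) : Integrable (delta m s) (haar m) :=
  integrable_of_measurable_of_norm_le (measurable_delta s) (norm_delta_le s)

lemma integral_delta (hm : ∀ k, 2 ≤ m k) (s : ℕ) : ∫ x, delta m s x ∂haar m = 1 := by
  have : (M m s : ℝ) ≠ 0 := by exact_mod_cast (M_pos hm s).ne'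
  rw [delta, integral_indicator (measurableSet_I s 0), setIntegral_const, haar_real_I, smul_eq_mul,
    inv_mul_cancel₀ this]

lemma integrable_majorant (s K : ℕ) : Integrable (majorant m s K) (haar m) := by
  unfold majorant
  exact integrable_finsetSum _ fun r _ => integrable_delta r

lemma integral_majorant (hm : ∀ k, 2 ≤ m k) (s K : ℕ) :
    ∫ x, majorant m s K x ∂haar m = ((K + 1 - s : ℕ) : ℝ) := by
  unfold majorant
  rw [integral_finsetSum _ fun r _ => integrable_delta r]
  simp [integral_delta hm]

lemma norm_quadKernel_le {c : ℕ → ℝ} {J : ℕ} {V R : ℝ}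
    (hc : ∑ j ∈ Finset.range J, |c j| ≤ V) (hR : (J : ℝ) - 1 ≤ R) (x y : G m) :
    ‖quadKernel m c J x y‖ ≤ V * R ^ 2 := by
  refine (norm_sum_cesaroA_mul_le _ _ _ (fun _ => R ^ 2) fun j hj => ?_).trans ?_
  · have h1 : (j : ℝ) + 1 ≤ J := by exact_mod_cast Finset.mem_range.1 hj
    have h2 := norm_dirichlet_le j x
    have h3 := norm_dirichlet_le j y
    rw [norm_mul, pow_two]
    exact mul_le_mul (by linarith) (by linarith) (norm_nonneg _)
      ((norm_nonneg _).trans (h2.trans (by linarith)))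
  · rw [← Finset.sum_mul]
    exact mul_le_mul_of_nonneg_right hc (sq_nonneg _)

lemma integrable_norm_quadKernel (c : ℕ → ℝ) (J : ℕ) :
    Integrable (fun z : G m × G m => ‖quadKernel m c J z.1 z.2‖) (haar2 m) := by
  refine integrable_of_measurable_of_norm_le (measurable_quadKernel c J).norm
    (C := (∑ j ∈ Finset.range J, |c j|) * (J : ℝ) ^ 2) fun z => ?_
  rw [norm_norm]
  exact norm_quadKernel_le le_rfl (by linarith) _ _

/-- The `L^1` norms of the Cesàro kernels grow at most logarithmically. -/
lemma integral_norm_cesaroKernel_le {α : ℝ} (h0 : 0 < α) (h1 : α < 1) (hm : ∀ k, 2 ≤ m k) {B : ℕ}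
    (hB : ∀ k, m k ≤ B) {n K : ℕ} (hn : n ≤ M m K) :
    ∫ z, ‖cesaroKernel m α n z.1 z.2‖ ∂haar2 m
      ≤ (2 * (B + 1) + (B + 4) / (1 - α)) * (B + 1) * (2 / (1 - 2 ^ (-α))) * (2 * (K + 1)) + 2 := by
  have hα : (0 : ℝ) < 1 - α := by linarith
  set C : ℝ := (2 * (B + 1) + (B + 4) / (1 - α)) * (B + 1) with hC
  have hC0 : 0 ≤ C := by positivity
  have hβ : ∀ s, 0 ≤ scaleBound m α n s := fun s => by
    unfold scaleBound
    split_ifs <;> positivity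
  -- Off `I_K × I_K` a single scale `s` suffices, with two symmetric terms according to which
  -- coordinate leaves `I_s` first. On `I_K × I_K` the trivial bound holds: total weight at most
  -- `2`, Dirichlet kernels at most `M_K`.
  have pw : ∀ z : G m × G m, ‖cesaroKernel m α n z.1 z.2‖
      ≤ ∑ s ∈ Finset.range K, C * scaleBound m α n s *
          (delta m s z.1 * majorant m s K z.2 + majorant m s K z.1 * delta m s z.2)
        + 2 * (delta m K z.1 * delta m K z.2) := by
    rintro ⟨x, y⟩
    have hnn : ∀ s, 0 ≤ C * scaleBound m α n s *
        (delta m s x * majorant m s K y + majorant m s K x * delta m s y) := fun s => by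
      have := delta_nonneg s x
      have := delta_nonneg s y
      have := majorant_nonneg s K x
      have := majorant_nonneg s K y
      have := hβ s
      positivity
    by_cases hxy : x ∈ I m K 0 ∧ y ∈ I m K 0
    · have : ‖cesaroKernel m α n x y‖ ≤ 2 * (delta m K x * delta m K y) := by
        rw [cesaroKernel_eq_quadKernel, delta_of_mem hxy.1, delta_of_mem hxy.2, ← pow_two]
        refine norm_quadKernel_le ?_ (by push_cast; simpa using hn) x y
        rw [← Finset.sum_range_reflect]
        refine le_trans (le_of_eq ?_) (sum_range_abs_cesaroA_le h0 h1 (n + 1))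
        refine Finset.sum_congr rfl fun j hj => ?_
        congr 2
        simp at hj
        omega
      have := Finset.sum_nonneg fun s (_ : s ∈ Finset.range K) => hnn s
      dsimp only
      linarith
    · obtain ⟨s, hs, hx, hy, hne⟩ := exists_scale hxy
      have h2 : 0 ≤ 2 * (delta m K x * delta m K y) := by
        have := mul_nonneg (delta_nonneg K x) (delta_nonneg K y)
        linarith
      have h3 := Finset.single_le_sum (f := fun s => C * scaleBound m α n s *
        (delta m s x * majorant m s K y + majorant m s K x * delta m s y))
        (fun s _ => hnn s) (Finset.mem_range.2 hs)
      have p1 : 0 ≤ C * scaleBound m α n s * (delta m s x * majorant m s K y) :=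
        mul_nonneg (mul_nonneg hC0 (hβ s)) (mul_nonneg (delta_nonneg s x) (majorant_nonneg s K y))
      have p2 : 0 ≤ C * scaleBound m α n s * (majorant m s K x * delta m s y) :=
        mul_nonneg (mul_nonneg hC0 (hβ s)) (mul_nonneg (majorant_nonneg s K x) (delta_nonneg s y))
      dsimp only at h3 ⊢
      rcases hne with h | h
      · have := norm_cesaroKernel_le h0 h1 hm hB hs.le hn hx h hy
        linarith
      · have := norm_cesaroKernel_le h0 h1 hm hB hs.le hn hy h hx
        rw [cesaroKernel_comm] at this
        linarith
  have i1 : ∀ s, Integrable (fun z : G m × G m => delta m s z.1 * majorant m s K z.2) (haar2 m) :=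
    fun s => (integrable_delta s).mul_prod (integrable_majorant s K)
  have i2 : ∀ s, Integrable (fun z : G m × G m => majorant m s K z.1 * delta m s z.2) (haar2 m) :=
    fun s => (integrable_majorant s K).mul_prod (integrable_delta s)
  have i3 : Integrable (fun z : G m × G m => delta m K z.1 * delta m K z.2) (haar2 m) :=
    (integrable_delta K).mul_prod (integrable_delta K)
  have i4 : ∀ s, Integrable (fun z : G m × G m => C * scaleBound m α n s *
      (delta m s z.1 * majorant m s K z.2 + majorant m s K z.1 * delta m s z.2)) (haar2 m) :=
    fun s => ((i1 s).add (i2 s)).const_mul _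
  have v1 : ∀ s, ∫ z, delta m s z.1 * majorant m s K z.2 ∂haar2 m = ((K + 1 - s : ℕ) : ℝ) :=
    fun s => by
      rw [haar2, integral_prod_mul (delta m s) (majorant m s K), integral_delta hm,
        integral_majorant hm, one_mul]
  have v2 : ∀ s, ∫ z, majorant m s K z.1 * delta m s z.2 ∂haar2 m = ((K + 1 - s : ℕ) : ℝ) :=
    fun s => by
      rw [haar2, integral_prod_mul (majorant m s K) (delta m s), integral_delta hm,
        integral_majorant hm, mul_one]
  have v3 : ∫ z, delta m K z.1 * delta m K z.2 ∂haar2 m = 1 := by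
    rw [haar2, integral_prod_mul (delta m K) (delta m K), integral_delta hm, one_mul]
  have hint : Integrable (fun z : G m × G m => ‖cesaroKernel m α n z.1 z.2‖) (haar2 m) := by
    simp only [cesaroKernel_eq_quadKernel]
    exact integrable_norm_quadKernel _ _
  refine (integral_mono hint ((integrable_finsetSum _ fun s _ => i4 s).add (i3.const_mul 2))
    pw).trans ?_
  rw [integral_add' (integrable_finsetSum _ fun s _ => i4 s) (i3.const_mul 2),
    integral_finsetSum _ fun s _ => i4 s, integral_const_mul, v3, mul_one]
  refine add_le_add_left ?_ _
  calc _ = ∑ s ∈ Finset.range K, C * scaleBound m α n s * (2 * ((K + 1 - s : ℕ) : ℝ)) := by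
        refine Finset.sum_congr rfl fun s _ => ?_
        rw [integral_const_mul, integral_add (i1 s) (i2 s), v1, v2]
        ring
    _ ≤ ∑ s ∈ Finset.range K, C * scaleBound m α n s * (2 * (K + 1)) := by
        refine Finset.sum_le_sum fun s _ => ?_
        have h5 : ((K + 1 - s : ℕ) : ℝ) ≤ K + 1 := by
          exact_mod_cast Nat.sub_le (K + 1) s
        have := hβ s
        gcongr
    _ = C * (∑ s ∈ Finset.range K, scaleBound m α n s) * (2 * (K + 1)) := by
        rw [Finset.mul_sum, Finset.sum_mul]
    _ ≤ _ := by
        gcongr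
        exact sum_scaleBound_le h0 hm n K

end KernelIntegrals

end Vilenkin

namespace Vilenkin

/-! ### Weighted quadratic Dirichlet kernels in `L^1`, by orthogonality. -/

section QuadraticKernels

lemma sum_range_mul {E : Type*} [AddCommMonoid E] (f : ℕ → E) (Q T : ℕ) :
    ∑ j ∈ Finset.range (Q * T), f j
      = ∑ N ∈ Finset.range Q, ∑ l ∈ Finset.range T, f (N * T + l) := by
  induction Q with
  | zero => simp
  | succ Q ih => rw [Nat.succ_mul, Finset.sum_range_add, ih, Finset.sum_range_succ]

variable {m : ℕ → ℕ}

/-- The indicator function of the annulus `I_s \ I_{s+1}`. -/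
noncomputable def annulus (m : ℕ → ℕ) (s : ℕ) : G m → ℝ :=
  {x : G m | x ∈ I m s 0 ∧ x s ≠ 0}.indicator 1

lemma annulus_nonneg (s : ℕ) (x : G m) : 0 ≤ annulus m s x :=
  Set.indicator_nonneg (fun _ _ => zero_le_one) x

lemma annulus_of_mem {s : ℕ} {x : G m} (hx : x ∈ I m s 0) (hxs : x s ≠ 0) : annulus m s x = 1 :=
  Set.indicator_of_mem (show x ∈ {x : G m | x ∈ I m s 0 ∧ x s ≠ 0} from ⟨hx, hxs⟩) _

lemma annulus_of_not {s : ℕ} {x : G m} (hx : ¬ (x ∈ I m s 0 ∧ x s ≠ 0)) : annulus m s x = 0 :=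
  Set.indicator_of_notMem (show x ∉ {x : G m | x ∈ I m s 0 ∧ x s ≠ 0} from hx) _

lemma annulus_le_one (s : ℕ) (x : G m) : annulus m s x ≤ 1 :=
  Set.indicator_apply_le' (fun _ => le_rfl) fun _ => zero_le_one

lemma annulus_add (s : ℕ) {e : G m} (he : e ∈ I m (s + 1) 0) (x : G m) :
    annulus m s (e + x) = annulus m s x := by
  have h1 : ∀ j ≤ s, (e + x) j = x j := fun j hj => by simp [he j (by omega)]
  have h2 : (e + x ∈ I m s 0 ∧ (e + x) s ≠ 0) ↔ (x ∈ I m s 0 ∧ x s ≠ 0) := by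
    rw [h1 s le_rfl, mem_I_zero, mem_I_zero]
    refine and_congr_left fun _ => forall₂_congr fun j hj => ?_
    rw [h1 j hj.le]
  by_cases h : x ∈ I m s 0 ∧ x s ≠ 0
  · rw [annulus_of_mem h.1 h.2, annulus_of_mem (h2.2 h).1 (h2.2 h).2]
  · rw [annulus_of_not h, annulus_of_not (fun h' => h (h2.1 h'))]

@[fun_prop]
lemma measurable_annulus (s : ℕ) : Measurable (annulus m s) := by
  refine measurable_one.indicator ((measurableSet_I s 0).inter ?_)
  exact (measurable_pi_apply (X := fun k => ZMod (m k)) s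
    (MeasurableSet.singleton (0 : ZMod (m s)))).compl

variable [∀ k, NeZero (m k)]

lemma dirichlet_add_of_mem (hm : ∀ k, 2 ≤ m k) {j t : ℕ} (hj : j ≤ M m t) {e : G m}
    (he : e ∈ I m t 0) (x : G m) : dirichlet m j (e + x) = dirichlet m j x := by
  refine Finset.sum_congr rfl fun a ha => ?_
  rw [psi_add, psi_of_mem_I hm ((Finset.mem_range.1 ha).trans_le hj) he, one_mul]

/-- Bessel's identity for trigonometric polynomials in the characters `ψ_{N M_t}` whose
coefficients are functions invariant under `I_t`. -/
lemma integral_norm_sq_sum (hm : ∀ k, 2 ≤ m k) (t Q : ℕ) {b : ℕ → G m → ℂ} {C : ℝ}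
    (hbm : ∀ N, Measurable (b N)) (hbC : ∀ N x, ‖b N x‖ ≤ C)
    (hb : ∀ N, ∀ e ∈ I m t 0, ∀ x, b N (e + x) = b N x) :
    ∫ x, ‖∑ N ∈ Finset.range Q, b N x * psi m (N * M m t) x‖ ^ 2 ∂haar m
      = ∑ N ∈ Finset.range Q, ∫ x, ‖b N x‖ ^ 2 ∂haar m := by
  have hcc : ∀ z : ℂ, ((‖z‖ ^ 2 : ℝ) : ℂ) = z * (starRingEnd ℂ) z := fun z => by
    rw [Complex.mul_conj, Complex.normSq_eq_norm_sq]
  have hint : ∀ N N', Integrable (fun x => b N x * (starRingEnd ℂ) (b N' x) *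
      (psi m (N * M m t) x * (starRingEnd ℂ) (psi m (N' * M m t) x))) (haar m) := by
    intro N N'
    have := hbm N
    have := hbm N'
    refine integrable_of_measurable_of_norm_le (by fun_prop) (C := C * C) fun x => ?_
    simp only [norm_mul, RCLike.norm_conj, norm_psi, mul_one]
    exact mul_le_mul (hbC N x) (hbC N' x) (norm_nonneg _) ((norm_nonneg _).trans (hbC N x))
  rw [← Complex.ofReal_inj, Complex.ofReal_sum]
  simp only [← integral_complex_ofReal, hcc]
  have e : ∀ x, (∑ N ∈ Finset.range Q, b N x * psi m (N * M m t) x)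
      * (starRingEnd ℂ) (∑ N ∈ Finset.range Q, b N x * psi m (N * M m t) x)
      = ∑ N ∈ Finset.range Q, ∑ N' ∈ Finset.range Q, b N x * (starRingEnd ℂ) (b N' x) *
      (psi m (N * M m t) x * (starRingEnd ℂ) (psi m (N' * M m t) x)) := by
    intro x
    rw [map_sum, Finset.sum_mul_sum]
    refine Finset.sum_congr rfl fun N _ => Finset.sum_congr rfl fun N' _ => ?_
    rw [map_mul]
    ring
  simp only [e]
  rw [integral_finsetSum _ fun N _ => integrable_finsetSum _ fun N' _ => hint N N']
  refine Finset.sum_congr rfl fun N hN => ?_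
  rw [integral_finsetSum _ fun N' _ => hint N N', Finset.sum_eq_single_of_mem N hN]
  · refine integral_congr_ae (Filter.Eventually.of_forall fun x => ?_)
    simp only
    rw [← hcc (psi m _ x), norm_psi]
    simp
  · intro N' _ hNN
    refine integral_mul_psi_mul_conj_psi hm (s := t) (fun h => hNN ?_) (Dvd.intro_left _ rfl)
      (Dvd.intro_left _ rfl) fun e he x => ?_
    · exact (Nat.eq_of_mul_eq_mul_right (M_pos hm t) h).symm
    · rw [hb N e he, hb N' e he]

/-- Write `j = N T + l` with `T = M_{s+1}`. On the annulus `D_{NT}(x) = 0`, so `D_j(x) = ψ_{NT}(x)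
D_l(x)` and the kernel becomes `∑_N b_N ψ_{NT}` with `I_{s+1}`-invariant coefficients. Bessel's
identity and Cauchy–Schwarz on `I_s` then give a factor `√Q` in place of the `Q` of the triangle
inequality. -/
lemma integral_annulus_mul_norm_quadKernel_le (hm : ∀ k, 2 ≤ m k) {B : ℕ} (hB : ∀ k, m k ≤ B)
    {c : ℕ → ℝ} {W : ℝ} (hW : 0 < W) {s K Q : ℕ} (hs : s < K) (hQ : M m K = Q * M m (s + 1))
    (hc : ∀ j < M m K, |c j| ≤ W) {y : G m} (hy : y ∈ I m s 0) :
    ∫ x, annulus m s x * ‖quadKernel m c (M m K) x y‖ ∂haar m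
      ≤ W * (B + 1) ^ 2 * M m K * (√Q)⁻¹ * majorant m s K y := by
  set T := M m (s + 1) with hT
  have hT0 : (0 : ℝ) < T := by exact_mod_cast M_pos hm (s + 1)
  have hMs : (0 : ℝ) < M m s := by exact_mod_cast M_pos hm s
  have hQ0 : (0 : ℝ) < Q := by
    have := M_pos hm K
    exact_mod_cast Nat.pos_of_ne_zero (by rintro rfl; simp at hQ; omega)
  set Λ := majorant m s K y with hΛ
  have hΛ0 : 0 < Λ := hMs.trans_le (le_majorant hs.le hy)
  set R : ℝ := T * (W * ((B + 1) * ((B + 1) * Λ))) with hR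
  have hR0 : 0 < R := by positivity
  -- Truncation at `N < Q` makes the bound on `b N` valid for every `N`, although the weights are
  -- controlled only below `M_K`.
  let b : ℕ → G m → ℂ := fun N x => (annulus m s x : ℂ) *
    if N < Q then ∑ l ∈ Finset.range T, (c (N * T + l) : ℂ) *
      (dirichlet m l x * dirichlet m (N * T + l) y) else 0
  have hbm : ∀ N, Measurable (b N) := by
    intro N
    simp only [b]
    split_ifs <;> fun_prop
  have hbR : ∀ N x, ‖b N x‖ ≤ R * delta m s x := by
    intro N x
    have hnn : 0 ≤ R * delta m s x := mul_nonneg hR0.le (delta_nonneg s x)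
    by_cases hx : x ∈ I m s 0 ∧ x s ≠ 0
    · simp only [b]
      split_ifs with hN
      · rw [annulus_of_mem hx.1 hx.2, Complex.ofReal_one, one_mul]
        have hlt : ∀ l < T, N * T + l < M m K := fun l hl => by
          rw [hQ]
          calc N * T + l < N * T + T := by omega
            _ = (N + 1) * T := by ring
            _ ≤ Q * T := Nat.mul_le_mul_right _ hN
        refine (norm_sum_cesaroA_mul_le _ _ _
          (fun _ => ((B + 1) * M m s) * ((B + 1) * Λ)) fun l hl => ?_).trans ?_
        · have hl' := Finset.mem_range.1 hl
          rw [norm_mul]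
          refine mul_le_mul ?_ (norm_dirichlet_le_majorant hm hB hs.le (hlt l hl').le hy)
            (norm_nonneg _) (by positivity)
          have := norm_dirichlet_le_majorant hm hB (j := l) (s := s) (K := s + 1) (by omega)
            hl'.le hx.1
          rwa [majorant_eq (by omega) hx.1 hx.2] at this
        · rw [delta_of_mem hx.1]
          calc _ ≤ ∑ l ∈ Finset.range T, W * (((B + 1) * M m s) * ((B + 1) * Λ)) := by
                refine Finset.sum_le_sum fun l hl => ?_
                have := hc _ (hlt l (Finset.mem_range.1 hl))
                gcongr
            _ = _ := by
                rw [Finset.sum_const, Finset.card_range, nsmul_eq_mul, hR]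
                ring
      · simpa using hnn
    · simp only [b]
      rw [annulus_of_not hx]
      simpa using hnn
  have hbC : ∀ N x, ‖b N x‖ ≤ R * M m s := fun N x => (hbR N x).trans <| by
    have := (le_abs_self _).trans (norm_delta_le s x)
    gcongr
  have hbI : ∀ N, ∀ e ∈ I m (s + 1) 0, ∀ x, b N (e + x) = b N x := by
    intro N e he x
    simp only [b]
    rw [annulus_add s he]
    split_ifs with hN
    · congr 1
      refine Finset.sum_congr rfl fun l hl => ?_
      rw [dirichlet_add_of_mem hm (Finset.mem_range.1 hl).le he]
    · rfl
  have hF : ∀ x, (annulus m s x : ℂ) * quadKernel m c (M m K) x y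
      = ∑ N ∈ Finset.range Q, b N x * psi m (N * T) x := by
    intro x
    by_cases hx : x ∈ I m s 0 ∧ x s ≠ 0
    · rw [quadKernel, hQ, sum_range_mul, Finset.mul_sum]
      refine Finset.sum_congr rfl fun N hN => ?_
      simp only [b, if_pos (Finset.mem_range.1 hN)]
      rw [mul_assoc]
      congr 1
      rw [Finset.sum_mul]
      refine Finset.sum_congr rfl fun l hl => ?_
      rw [dirichlet_mul_M_add hm N (s + 1) (Finset.mem_range.1 hl).le,
        dirichlet_mul_M_eq_zero hm _ hx.2]
      ring
    · simp [b, annulus_of_not hx]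
  have hV := integral_norm_sq_sum hm (s + 1) Q hbm hbC hbI
  have hdd : ∫ x, delta m s x ^ 2 ∂haar m = M m s := by
    have : ∀ x, delta m s x ^ 2 = M m s * delta m s x := by
      intro x
      by_cases hx : x ∈ I m s 0
      · rw [delta_of_mem hx, pow_two]
      · rw [delta_of_notMem hx]; simp
    simp only [this]
    rw [integral_const_mul, integral_delta hm, mul_one]
  have hid : Integrable (fun x => R ^ 2 * delta m s x ^ 2) (haar m) := by
    refine Integrable.const_mul ?_ _
    refine integrable_of_measurable_of_norm_le (by fun_prop) (C := (M m s : ℝ) ^ 2) fun x => ?_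
    rw [norm_pow]
    have := norm_delta_le s x
    gcongr
  have hV' : ∫ x, ‖∑ N ∈ Finset.range Q, b N x * psi m (N * T) x‖ ^ 2 ∂haar m
      ≤ Q * (R ^ 2 * M m s) := by
    rw [hV]
    calc _ ≤ ∑ N ∈ Finset.range Q, R ^ 2 * M m s := by
          refine Finset.sum_le_sum fun N _ => ?_
          rw [← hdd, ← integral_const_mul]
          refine integral_mono_of_nonneg (Filter.Eventually.of_forall fun x => by positivity) hid
            (Filter.Eventually.of_forall fun x => ?_)
          simp only
          rw [← mul_pow]
          have := hbR N x
          gcongr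
      _ = _ := by simp
  set g : G m → ℝ := fun x => ‖∑ N ∈ Finset.range Q, b N x * psi m (N * T) x‖ with hg
  have hgm : Measurable g := by
    refine Measurable.norm (Finset.measurable_sum _ fun N _ => ?_)
    have := hbm N
    fun_prop
  have hgC : ∀ x, g x ≤ Q * (R * M m s) := by
    intro x
    refine (norm_sum_le _ _).trans ?_
    calc _ ≤ ∑ N ∈ Finset.range Q, R * M m s := by
          refine Finset.sum_le_sum fun N _ => ?_
          rw [norm_mul, norm_psi, mul_one]
          exact hbC N x
      _ = _ := by simp
  have hg0 : ∀ x, 0 ≤ g x := fun x => norm_nonneg _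
  have hgF : ∀ x, annulus m s x * ‖quadKernel m c (M m K) x y‖ = g x := by
    intro x
    rw [hg]
    simp only
    rw [← hF, norm_mul, Complex.norm_real, Real.norm_of_nonneg (annulus_nonneg s x)]
  simp only [hgF]
  -- Cauchy–Schwarz is replaced by `g ≤ lam/2 + g²/(2 lam)` on `I_s`; the optimal `lam` is the bound
  -- for the root mean square of `g` on `I_s`, a set of measure `1 / M_s`.
  set lam : ℝ := R * M m s * √Q with hlam
  have hsq : 0 < √(Q : ℝ) := Real.sqrt_pos.2 hQ0
  have hlam0 : 0 < lam := by positivity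
  have hgi : Integrable (fun x => g x ^ 2) (haar m) := by
    refine integrable_of_measurable_of_norm_le (by fun_prop) (C := (Q * (R * M m s)) ^ 2)
      fun x => ?_
    rw [norm_pow, Real.norm_of_nonneg (hg0 x)]
    have := hgC x
    have := hg0 x
    gcongr
  have amgm : ∀ x, g x ≤ lam / M m s / 2 * delta m s x + (2 * lam)⁻¹ * g x ^ 2 := by
    intro x
    by_cases hx : x ∈ I m s 0
    · rw [delta_of_mem hx]
      have h1 : lam / M m s / 2 * M m s = lam / 2 := by field_simp
      rw [h1]
      have h2 : 0 ≤ (2 * lam)⁻¹ * (g x - lam) ^ 2 := by positivity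
      have h3 : (2 * lam)⁻¹ * (g x - lam) ^ 2 = lam / 2 + (2 * lam)⁻¹ * g x ^ 2 - g x := by
        field_simp; ring
      linarith
    · have h0 : g x = 0 := by
        rw [← hgF, annulus_of_not (fun h => hx h.1), zero_mul]
      rw [delta_of_notMem hx, h0]
      simp
  calc ∫ x, g x ∂haar m
      ≤ ∫ x, lam / M m s / 2 * delta m s x + (2 * lam)⁻¹ * g x ^ 2 ∂haar m := by
        refine integral_mono_of_nonneg (Filter.Eventually.of_forall hg0) ?_
          (Filter.Eventually.of_forall amgm)
        exact ((integrable_delta s).const_mul _).add (hgi.const_mul _)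
    _ = lam / M m s / 2 + (2 * lam)⁻¹ * ∫ x, g x ^ 2 ∂haar m := by
        rw [integral_add ((integrable_delta s).const_mul _) (hgi.const_mul _),
          integral_const_mul, integral_const_mul, integral_delta hm, mul_one]
    _ ≤ lam / M m s / 2 + (2 * lam)⁻¹ * (Q * (R ^ 2 * M m s)) := by gcongr
    _ = R * √Q := by
        have hQs : (Q : ℝ) = √Q * √Q := (Real.mul_self_sqrt hQ0.le).symm
        rw [hlam]
        nth_rw 3 [hQs]
        field_simp
        ring
    _ = _ := by
        have hQs : (Q : ℝ) = √Q * √Q := (Real.mul_self_sqrt hQ0.le).symm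
        rw [hQ, Nat.cast_mul, hR]
        nth_rw 2 [hQs]
        field_simp

/-- The constant in the bound for the `L^1` norms of quadratic Dirichlet kernels. -/
noncomputable def quadConst (B : ℕ) : ℝ :=
  2 * (B + 1) ^ 2 * ∑' d : ℕ, ((d : ℝ) + 2) * ((√2)⁻¹) ^ d + 1

lemma sqrt_two_inv_lt_one : (√2)⁻¹ < (1 : ℝ) := by
  refine inv_lt_one_of_one_lt₀ ?_
  rw [Real.lt_sqrt (by norm_num)]
  norm_num

lemma summable_add_two_mul_pow : Summable fun d : ℕ => ((d : ℝ) + 2) * ((√2)⁻¹) ^ d := by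
  have h : ‖(√2)⁻¹‖ < (1 : ℝ) := by
    rw [Real.norm_of_nonneg (by positivity)]
    exact sqrt_two_inv_lt_one
  have h1 := summable_pow_mul_geometric_of_norm_lt_one 1 h
  have h2 := (summable_geometric_of_norm_lt_one h).mul_left 2
  refine (h1.add h2).congr fun d => ?_
  ring

lemma quadConst_pos (B : ℕ) : 0 < quadConst B := by
  have : 0 ≤ ∑' d : ℕ, ((d : ℝ) + 2) * ((√2)⁻¹) ^ d := tsum_nonneg fun d => by positivity
  unfold quadConst
  positivity

omit [∀ k, NeZero (m k)] in
lemma two_pow_mul_M_le (hm : ∀ k, 2 ≤ m k) (s d : ℕ) : 2 ^ d * M m s ≤ M m (s + d) := by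
  induction d with
  | zero => simp
  | succ d ih =>
    rw [← add_assoc, M, pow_succ, mul_comm (2 ^ d), mul_assoc]
    exact Nat.mul_le_mul (hm _) ih

/-- The `L^1` norm of a sum of quadratic Dirichlet kernels of order less than `M_K` with bounded
weights is at most of the order of `M_K`. -/
lemma integral_norm_quadKernel_le (hm : ∀ k, 2 ≤ m k) {B : ℕ} (hB : ∀ k, m k ≤ B)
    {c : ℕ → ℝ} {W : ℝ} (hW : 0 < W) (K : ℕ) (hc : ∀ j < M m K, |c j| ≤ W) :
    ∫ z, ‖quadKernel m c (M m K) z.1 z.2‖ ∂haar2 m ≤ quadConst B * (W * M m K) := by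
  set F : G m → G m → ℝ := fun x y => ‖quadKernel m c (M m K) x y‖ with hF
  have hFm : Measurable fun z : G m × G m => F z.1 z.2 := (measurable_quadKernel c _).norm
  obtain ⟨C, hFC⟩ : ∃ C, ∀ x y, F x y ≤ C :=
    ⟨_, fun x y => norm_quadKernel_le le_rfl (show ((M m K : ℕ) : ℝ) - 1 ≤ M m K by linarith) x y⟩
  have hF0 : ∀ x y, 0 ≤ F x y := fun x y => norm_nonneg _
  have hC0 : 0 ≤ C := (hF0 0 0).trans (hFC 0 0)
  -- `A s` is the part where `x` leaves at scale `s` while `y ∈ I_s`, and `A' s` its mirror image;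
  -- the kernel is symmetric, so their integrals agree.
  let A : ℕ → G m × G m → ℝ := fun s z =>
    (I m s 0).indicator 1 z.2 * (annulus m s z.1 * F z.1 z.2)
  let A' : ℕ → G m × G m → ℝ := fun s z => A s z.swap
  have hind : ∀ s (x : G m), 0 ≤ (I m s 0).indicator (1 : G m → ℝ) x ∧
      (I m s 0).indicator (1 : G m → ℝ) x ≤ 1 := fun s x =>
    ⟨Set.indicator_nonneg (fun _ _ => zero_le_one) x,
      Set.indicator_apply_le' (fun _ => le_rfl) fun _ => zero_le_one⟩
  have hA0 : ∀ s z, 0 ≤ A s z := fun s z =>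
    mul_nonneg (hind s z.2).1 (mul_nonneg (annulus_nonneg s z.1) (hF0 _ _))
  have hAm : ∀ s, Measurable (A s) := fun s => by
    refine Measurable.mul ?_ (Measurable.mul ?_ hFm)
    · exact (measurable_one.indicator (measurableSet_I s 0)).comp measurable_snd
    · fun_prop
  have hAi : ∀ s, Integrable (A s) (haar2 m) := fun s => by
    refine integrable_of_measurable_of_norm_le (hAm s) (C := C) fun z => ?_
    rw [Real.norm_of_nonneg (hA0 s z)]
    calc A s z ≤ 1 * (1 * C) := by
          have h1 := (hind s z.2).2
          have h2 := annulus_le_one s z.1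
          have h3 := hFC z.1 z.2
          have h4 := hF0 z.1 z.2
          have h5 := annulus_nonneg s z.1
          exact mul_le_mul h1 (mul_le_mul h2 h3 h4 zero_le_one) (mul_nonneg h5 h4) zero_le_one
      _ = C := by ring
  have hA'i : ∀ s, Integrable (A' s) (haar2 m) := fun s => (hAi s).swap
  have hswap : ∀ s, ∫ z, A' s z ∂haar2 m = ∫ z, A s z ∂haar2 m := fun s =>
    integral_prod_swap (μ := haar m) (ν := haar m) (A s)
  have i3 : Integrable (fun z : G m × G m => W * M m K * (delta m K z.1 * delta m K z.2))
      (haar2 m) := ((integrable_delta K).mul_prod (integrable_delta K)).const_mul _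
  have pw : ∀ z : G m × G m, F z.1 z.2 ≤ ∑ s ∈ Finset.range K, (A s z + A' s z)
      + W * M m K * (delta m K z.1 * delta m K z.2) := by
    rintro ⟨x, y⟩
    have hnn : ∀ s, 0 ≤ A s (x, y) + A' s (x, y) := fun s => add_nonneg (hA0 s _) (hA0 s _)
    by_cases hxy : x ∈ I m K 0 ∧ y ∈ I m K 0
    · have h1 := Finset.sum_nonneg fun s (_ : s ∈ Finset.range K) => hnn s
      have h2 : F x y ≤ W * M m K * (delta m K x * delta m K y) := by
        rw [delta_of_mem hxy.1, delta_of_mem hxy.2, ← pow_two, mul_comm W]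
        refine norm_quadKernel_le ?_ (by linarith) x y
        refine (Finset.sum_le_sum fun j hj => hc j (Finset.mem_range.1 hj)).trans ?_
        simp
      dsimp only
      linarith
    · obtain ⟨s, hs, hx, hy, hne⟩ := exists_scale hxy
      have h2 : 0 ≤ W * M m K * (delta m K x * delta m K y) :=
        mul_nonneg (by positivity) (mul_nonneg (delta_nonneg K x) (delta_nonneg K y))
      have h3 := Finset.single_le_sum (f := fun s => A s (x, y) + A' s (x, y))
        (fun s _ => hnn s) (Finset.mem_range.2 hs)
      have p1 := hA0 s (x, y)
      have p2 := hA0 s (y, x)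
      have hxi : (I m s 0).indicator (1 : G m → ℝ) x = 1 := Set.indicator_of_mem hx _
      have hyi : (I m s 0).indicator (1 : G m → ℝ) y = 1 := Set.indicator_of_mem hy _
      simp only [A', A, Prod.swap_prod_mk, hxi, hyi, one_mul] at h3 p1 p2 ⊢
      rcases hne with h | h
      · rw [annulus_of_mem hx h, one_mul] at h3
        linarith
      · have hsym : F y x = F x y := by simp only [hF, quadKernel_comm c _ y x]
        rw [annulus_of_mem hy h, one_mul] at h3
        linarith
  -- The gain `1/√Q` with `Q ≥ 2^{K-1-s}` outweighs the integral `K + 1 - s` of the majorant, so the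
  -- sum over scales is bounded by a convergent series.
  have hscale : ∀ s < K, ∫ z, A s z ∂haar2 m
      ≤ (B + 1) ^ 2 * (W * M m K) * ((((K - 1 - s : ℕ) : ℝ) + 2) * ((√2)⁻¹) ^ (K - 1 - s)) := by
    intro s hs
    obtain ⟨Q, hQ⟩ := M_dvd_M (m := m) (show s + 1 ≤ K from hs)
    rw [mul_comm] at hQ
    have hQ2 : 2 ^ (K - 1 - s) ≤ Q := by
      have h1 := two_pow_mul_M_le hm (s + 1) (K - 1 - s)
      rw [show s + 1 + (K - 1 - s) = K by omega, hQ] at h1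
      exact Nat.le_of_mul_le_mul_right h1 (M_pos hm _)
    have hQs : (√(Q : ℝ))⁻¹ ≤ ((√2)⁻¹) ^ (K - 1 - s) := by
      rw [inv_pow]
      refine inv_anti₀ (by positivity) ?_
      refine Real.le_sqrt_of_sq_le ?_
      rw [← pow_mul, mul_comm, pow_mul, Real.sq_sqrt (by norm_num)]
      exact_mod_cast hQ2
    have hin : ∀ y, ∫ x, A s (x, y) ∂haar m
        ≤ W * (B + 1) ^ 2 * M m K * (√Q)⁻¹ * majorant m s K y := by
      intro y
      by_cases hy : y ∈ I m s 0
      · have hyi : (I m s 0).indicator (1 : G m → ℝ) y = 1 := Set.indicator_of_mem hy _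
        simp only [A, hyi, one_mul]
        exact integral_annulus_mul_norm_quadKernel_le hm hB hW hs hQ hc hy
      · have hyi : (I m s 0).indicator (1 : G m → ℝ) y = 0 := Set.indicator_of_notMem hy _
        simp only [A, hyi, zero_mul, integral_zero]
        have := majorant_nonneg s K y
        positivity
    calc ∫ z, A s z ∂haar2 m = ∫ y, ∫ x, A s (x, y) ∂haar m ∂haar m :=
          integral_prod_symm (μ := haar m) (ν := haar m) (A s) (hAi s)
      _ ≤ ∫ y, W * (B + 1) ^ 2 * M m K * (√Q)⁻¹ * majorant m s K y ∂haar m :=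
          integral_mono (hAi s).integral_prod_right ((integrable_majorant s K).const_mul _) hin
      _ = W * (B + 1) ^ 2 * M m K * (√Q)⁻¹ * ((K + 1 - s : ℕ) : ℝ) := by
          rw [integral_const_mul, integral_majorant hm]
      _ ≤ W * (B + 1) ^ 2 * M m K * ((√2)⁻¹) ^ (K - 1 - s) * ((K + 1 - s : ℕ) : ℝ) := by gcongr
      _ = _ := by
          rw [show K + 1 - s = K - 1 - s + 2 by omega]
          push_cast
          ring
  have v3 : ∫ z, W * M m K * (delta m K z.1 * delta m K z.2) ∂haar2 m = W * M m K := by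
    rw [integral_const_mul, haar2, integral_prod_mul (delta m K) (delta m K), integral_delta hm]
    ring
  refine (integral_mono (integrable_norm_quadKernel c _)
    ((integrable_finsetSum _ fun s _ => (hAi s).add (hA'i s)).add i3) pw).trans ?_
  rw [integral_add' (integrable_finsetSum _ fun s _ => (hAi s).add (hA'i s)) i3, v3,
    integral_finsetSum _ fun s _ => (hAi s).add (hA'i s)]
  calc _ = ∑ s ∈ Finset.range K, 2 * ∫ z, A s z ∂haar2 m + W * M m K := by
        congr 1
        refine Finset.sum_congr rfl fun s _ => ?_
        rw [integral_add' (hAi s) (hA'i s), hswap, two_mul]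
    _ ≤ ∑ s ∈ Finset.range K, 2 * ((B + 1) ^ 2 * (W * M m K)
          * ((((K - 1 - s : ℕ) : ℝ) + 2) * ((√2)⁻¹) ^ (K - 1 - s))) + W * M m K := by
        gcongr with s hs
        exact hscale s (Finset.mem_range.1 hs)
    _ = 2 * (B + 1) ^ 2 * (W * M m K)
          * ∑ d ∈ Finset.range K, ((d : ℝ) + 2) * ((√2)⁻¹) ^ d + W * M m K := by
        rw [← Finset.sum_range_reflect (fun d : ℕ => ((d : ℝ) + 2) * ((√2)⁻¹) ^ d),
          Finset.mul_sum]
        congr 1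
        exact Finset.sum_congr rfl fun s _ => by ring
    _ ≤ 2 * (B + 1) ^ 2 * (W * M m K)
          * ∑' d : ℕ, ((d : ℝ) + 2) * ((√2)⁻¹) ^ d + W * M m K := by
        gcongr
        exact summable_add_two_mul_pow.sum_le_tsum _ fun d _ => by positivity
    _ = _ := by
        rw [quadConst]
        ring

end QuadraticKernels

end Vilenkin

namespace Vilenkin

/-! ### Minkowski's integral inequality for a kernel weight. -/

section Minkowski

/-- Minkowski's integral inequality for a weight `κ` and functions with uniformly bounded norms. -/
lemma eLpNorm_integral_mul_le {X Y : Type*} [MeasurableSpace X] [MeasurableSpace Y]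
    {μ : Measure X} {ν : Measure Y} [SFinite μ] {κ : Y → ℂ} (hκ : Measurable κ)
    (hκi : ∫⁻ w, ‖κ w‖ₑ ∂ν ≠ ∞) {Φ : X → Y → ℂ} (hΦ : Measurable (Function.uncurry Φ))
    {p : ℝ≥0∞} (hp : 1 ≤ p) {C : ℝ≥0∞} (h : ∀ w, κ w ≠ 0 → eLpNorm (fun x => Φ x w) p μ ≤ C) :
    eLpNorm (fun x => ∫ w, Φ x w * κ w ∂ν) p μ ≤ (∫⁻ w, ‖κ w‖ₑ ∂ν) * C := by
  -- With `‖κ‖` absorbed into a finite measure, the case `p < ∞` is the comparison of the `L^1` and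
  -- `L^p` norms on `ρ` followed by Tonelli; for `p = ∞` the two almost-everywhere quantifiers are
  -- exchanged.
  set ρ := ν.withDensity (fun w => ‖κ w‖ₑ) with hρ
  have hfin : IsFiniteMeasure ρ := isFiniteMeasure_withDensity hκi
  have hu : ρ Set.univ = ∫⁻ w, ‖κ w‖ₑ ∂ν := by
    rw [hρ, withDensity_apply _ MeasurableSet.univ, setLIntegral_univ]
  have hΦx : ∀ x, Measurable (Φ x) := fun x => hΦ.comp measurable_prodMk_left
  have hΦw : ∀ w, Measurable fun x => Φ x w := fun w => hΦ.comp measurable_prodMk_right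
  have hle : ∀ x, ‖∫ w, Φ x w * κ w ∂ν‖ₑ ≤ ∫⁻ w, ‖Φ x w‖ₑ ∂ρ := by
    intro x
    refine (enorm_integral_le_lintegral_enorm _).trans (le_of_eq ?_)
    rw [hρ, lintegral_withDensity_eq_lintegral_mul _ hκ.enorm (hΦx x).enorm]
    refine lintegral_congr fun w => ?_
    rw [enorm_mul, Pi.mul_apply, mul_comm]
  have hae : ∀ᵐ w ∂ρ, eLpNorm (fun x => Φ x w) p μ ≤ C := by
    rw [hρ, ae_withDensity_iff hκ.enorm]
    exact Filter.Eventually.of_forall fun w hw => h w (by simpa using hw)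
  rw [← hu]
  rcases eq_or_ne p ∞ with rfl | hpt
  · rw [eLpNorm_exponent_top]
    have hset : MeasurableSet {z : Y × X | ‖Φ z.2 z.1‖ₑ ≤ C} :=
      measurableSet_le ((hΦ.comp measurable_swap).enorm) measurable_const
    have h1 : ∀ᵐ w ∂ρ, ∀ᵐ x ∂μ, ‖Φ x w‖ₑ ≤ C := by
      filter_upwards [hae] with w hw
      rw [eLpNorm_exponent_top] at hw
      filter_upwards [enorm_ae_le_eLpNormEssSup (fun x => Φ x w) μ] with x hx
      exact hx.trans hw
    have h2 : ∀ᵐ x ∂μ, ∀ᵐ w ∂ρ, ‖Φ x w‖ₑ ≤ C := (Measure.ae_ae_comm hset).1 h1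
    refine eLpNormEssSup_le_of_ae_enorm_bound ?_
    filter_upwards [h2] with x hx
    refine (hle x).trans ((lintegral_mono_ae hx).trans ?_)
    rw [lintegral_const, mul_comm]
  · have hp0 : p ≠ 0 := (zero_lt_one.trans_le hp).ne'
    set q := p.toReal with hq
    have hq1 : 1 ≤ q := by
      rw [hq, ← ENNReal.toReal_one]
      exact ENNReal.toReal_mono hpt hp
    have hq0 : 0 < q := zero_lt_one.trans_le hq1
    have hpow : ∀ x, (∫⁻ w, ‖Φ x w‖ₑ ∂ρ) ^ q
        ≤ (∫⁻ w, ‖Φ x w‖ₑ ^ q ∂ρ) * ρ Set.univ ^ (q - 1) := by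
      intro x
      have h3 := eLpNorm_le_eLpNorm_mul_rpow_measure_univ hp (hΦx x).aestronglyMeasurable (μ := ρ)
      rw [eLpNorm_one_eq_lintegral_enorm, eLpNorm_eq_lintegral_rpow_enorm_toReal hp0 hpt,
        ENNReal.toReal_one, ← hq] at h3
      calc _ ≤ ((∫⁻ w, ‖Φ x w‖ₑ ^ q ∂ρ) ^ (1 / q) * ρ Set.univ ^ (1 / 1 - 1 / q)) ^ q := by
            gcongr
        _ = _ := by
            rw [ENNReal.mul_rpow_of_nonneg _ _ hq0.le, ← ENNReal.rpow_mul, ← ENNReal.rpow_mul,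
              one_div_mul_cancel hq0.ne', ENNReal.rpow_one]
            congr 2
            field_simp
    rw [eLpNorm_eq_lintegral_rpow_enorm_toReal hp0 hpt, ← hq, one_div,
      ENNReal.rpow_inv_le_iff hq0]
    calc _ ≤ ∫⁻ x, (∫⁻ w, ‖Φ x w‖ₑ ^ q ∂ρ) * ρ Set.univ ^ (q - 1) ∂μ := by
          refine lintegral_mono fun x => ?_
          refine le_trans ?_ (hpow x)
          have := hle x
          gcongr
      _ = (∫⁻ x, ∫⁻ w, ‖Φ x w‖ₑ ^ q ∂ρ ∂μ) * ρ Set.univ ^ (q - 1) := by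
          rw [lintegral_mul_const]
          exact Measurable.lintegral_prod_right' (f := fun z : X × Y => ‖Φ z.1 z.2‖ₑ ^ q)
            (hΦ.enorm.pow_const q)
      _ = (∫⁻ w, ∫⁻ x, ‖Φ x w‖ₑ ^ q ∂μ ∂ρ) * ρ Set.univ ^ (q - 1) := by
          rw [lintegral_lintegral_swap]
          exact (hΦ.enorm.pow_const q).aemeasurable
      _ ≤ (∫⁻ w, C ^ q ∂ρ) * ρ Set.univ ^ (q - 1) := by
          refine mul_le_mul_left (lintegral_mono_ae ?_) _
          filter_upwards [hae] with w hw
          rwa [eLpNorm_eq_lintegral_rpow_enorm_toReal hp0 hpt, ← hq, one_div,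
            ENNReal.rpow_inv_le_iff hq0] at hw
      _ = (ρ Set.univ * C) ^ q := by
          rw [lintegral_const, ENNReal.mul_rpow_of_nonneg _ _ hq0.le, mul_assoc, mul_comm]
          congr 1
          nth_rw 1 [← ENNReal.rpow_one (ρ Set.univ)]
          rw [← ENNReal.rpow_add_of_nonneg _ _ zero_le_one (by linarith)]
          congr 1
          ring

end Minkowski

/-! ### Partial sums as integral operators, and their approximation properties. -/

section Convolution

variable {m : ℕ → ℕ} [∀ k, NeZero (m k)] {f : G m × G m → ℂ}

omit [∀ k, NeZero (m k)] in
lemma integrable_mul_bounded (hf : Integrable f (haar2 m)) {g : G m × G m → ℂ}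
    (hg : Measurable g) {C : ℝ} (hC : ∀ z, ‖g z‖ ≤ C) :
    Integrable (fun z => f z * g z) (haar2 m) :=
  hf.mul_bdd hg.aestronglyMeasurable (Filter.Eventually.of_forall hC)

lemma integrable_translate (hf : Integrable f (haar2 m)) (z : G m × G m) :
    Integrable (fun w => f (z + w)) (haar2 m) :=
  ((measurePreserving_add_left (haar2 m) z).integrable_comp hf.1).2 hf

@[fun_prop]
lemma measurable_partialSum (a b : ℕ) : Measurable (partialSum m f a b) := by
  unfold partialSum
  fun_prop

/-- Translation by `z` and `|ψ| = 1` absorb the outer characters. Writing `f (z + w)` against a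
conjugated kernel avoids subtraction in the group. -/
lemma fourierCoeff_mul_psi (a b : ℕ) (z : G m × G m) :
    fourierCoeff m f a b * psi m a z.1 * psi m b z.2
      = ∫ w, f (z + w) * (starRingEnd ℂ) (psi m a w.1 * psi m b w.2) ∂haar2 m := by
  have h := integral_add_left_eq_self (μ := haar2 m)
    (fun w => f w * (starRingEnd ℂ) (psi m a w.1) * (starRingEnd ℂ) (psi m b w.2)) z
  have hu : ∀ (n : ℕ) (x : G m), psi m n x * (starRingEnd ℂ) (psi m n x) = 1 := fun n x => by
    rw [Complex.mul_conj, Complex.normSq_eq_norm_sq, norm_psi]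
    simp
  rw [fourierCoeff, ← h, mul_assoc, ← integral_mul_const]
  refine integral_congr_ae (Filter.Eventually.of_forall fun w => ?_)
  simp only [Prod.fst_add, Prod.snd_add, psi_add, map_mul]
  linear_combination (f (z + w) * (starRingEnd ℂ) (psi m a w.1) * (starRingEnd ℂ) (psi m b w.2))
    * (psi m a z.1 * (starRingEnd ℂ) (psi m a z.1) * hu b z.2 + hu a z.1)

lemma partialSum_eq_integral (hf : Integrable f (haar2 m)) (j : ℕ) (z : G m × G m) :
    partialSum m f j j z
      = ∫ w, f (z + w) * (starRingEnd ℂ) (dirichlet m j w.1 * dirichlet m j w.2) ∂haar2 m := by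
  have hi : ∀ a b, Integrable (fun w => f (z + w) *
      (starRingEnd ℂ) (psi m a w.1 * psi m b w.2)) (haar2 m) := fun a b =>
    integrable_mul_bounded (integrable_translate hf z) (by fun_prop) (C := 1) fun w => by
      rw [RCLike.norm_conj, norm_mul, norm_psi, norm_psi, one_mul]
  simp only [partialSum, fourierCoeff_mul_psi]
  have e : ∀ w : G m × G m, dirichlet m j w.1 * dirichlet m j w.2
      = ∑ a ∈ Finset.range j, ∑ b ∈ Finset.range j, psi m a w.1 * psi m b w.2 :=
    fun w => Finset.sum_mul_sum _ _ _ _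
  simp only [e, map_sum, Finset.mul_sum]
  rw [integral_finsetSum _ fun a _ => integrable_finsetSum _ fun b _ => hi a b]
  exact Finset.sum_congr rfl fun a _ => (integral_finsetSum _ fun b _ => hi a b).symm

lemma norm_dirichlet_mul_le (j : ℕ) (z : G m × G m) :
    ‖(starRingEnd ℂ) (dirichlet m j z.1 * dirichlet m j z.2)‖ ≤ (j : ℝ) * j := by
  rw [RCLike.norm_conj, norm_mul]
  exact mul_le_mul (norm_dirichlet_le _ _) (norm_dirichlet_le _ _) (norm_nonneg _)
    (Nat.cast_nonneg _)

lemma sum_mul_partialSum (hf : Integrable f (haar2 m)) (c : ℕ → ℝ) (J : ℕ) (z : G m × G m) :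
    ∑ j ∈ Finset.range J, (c j : ℂ) * partialSum m f j j z
      = ∫ w, f (z + w) * (starRingEnd ℂ) (quadKernel m c J w.1 w.2) ∂haar2 m := by
  simp only [quadKernel, map_sum, Finset.mul_sum, partialSum_eq_integral hf]
  rw [integral_finsetSum]
  · refine Finset.sum_congr rfl fun j _ => ?_
    rw [← integral_const_mul]
    refine integral_congr_ae (Filter.Eventually.of_forall fun w => ?_)
    simp only [map_mul, Complex.conj_ofReal]
    ring
  · intro j _
    have := (integrable_mul_bounded (integrable_translate hf z) (by fun_prop)
      (norm_dirichlet_mul_le j)).const_mul (c j : ℂ)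
    refine this.congr (Filter.Eventually.of_forall fun w => ?_)
    simp only [map_mul, Complex.conj_ofReal]
    ring

lemma eLpNorm_translate {E : Type*} [NormedAddCommGroup E] {g : G m × G m → E}
    (hg : AEStronglyMeasurable g (haar2 m)) (p : ℝ≥0∞) (w : G m × G m) :
    eLpNorm (fun z => g (z + w)) p (haar2 m) = eLpNorm g p (haar2 m) := by
  have := eLpNorm_comp_measurePreserving (p := p) hg (measurePreserving_add_left (haar2 m) w)
  rw [← this]
  simp only [Function.comp_def, add_comm w]

instance : MeasurableAdd₂ (G m × G m) where
  measurable_add := by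
    have h : Measurable fun q : (G m × G m) × (G m × G m) =>
        (q.1.1 + q.2.1, q.1.2 + q.2.2) := by fun_prop
    exact h

lemma eLpNorm_sum_mul_partialSum_le (hfm : Measurable f) (hf : Integrable f (haar2 m)) {p : ℝ≥0∞}
    (hp : 1 ≤ p) (c : ℕ → ℝ) (J : ℕ) :
    eLpNorm (fun z => ∑ j ∈ Finset.range J, (c j : ℂ) * partialSum m f j j z) p (haar2 m)
      ≤ ENNReal.ofReal (∫ z, ‖quadKernel m c J z.1 z.2‖ ∂haar2 m) * eLpNorm f p (haar2 m) := by
  have hi : Integrable (fun z : G m × G m => quadKernel m c J z.1 z.2) (haar2 m) :=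
    (integrable_norm_iff (measurable_quadKernel c J).aestronglyMeasurable).1
      (integrable_norm_quadKernel c J)
  have he : ∫⁻ w, ‖(starRingEnd ℂ) (quadKernel m c J w.1 w.2)‖ₑ ∂haar2 m
      = ENNReal.ofReal (∫ z, ‖quadKernel m c J z.1 z.2‖ ∂haar2 m) := by
    rw [ofReal_integral_norm_eq_lintegral_enorm hi]
    refine lintegral_congr fun w => ?_
    rw [← ofReal_norm, ← ofReal_norm, RCLike.norm_conj]
  simp only [sum_mul_partialSum hf]
  rw [← he]
  refine eLpNorm_integral_mul_le (Φ := fun z w => f (z + w)) (by fun_prop)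
    (by rw [he]; exact ENNReal.ofReal_ne_top) ?_ hp fun w _ =>
      (eLpNorm_translate hfm.aestronglyMeasurable p w).le
  exact hfm.comp (measurable_fst.add measurable_snd)

/-- The block partial sums are near the function, in terms of the moduli of continuity. -/
lemma eLpNorm_sub_partialSum_M_le (hm : ∀ k, 2 ≤ m k) (hfm : Measurable f)
    (hf : Integrable f (haar2 m)) {p : ℝ≥0∞} (hp : 1 ≤ p) (r : ℕ) :
    eLpNorm (fun z => f z - partialSum m f (M m r) (M m r) z) p (haar2 m)
      ≤ omega1 m f r p + omega2 m f r p := by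
  -- The sign is chosen so that `f - S f` is the integral of `(f (z + w) - f z) κ(w)`; `κ` lives on
  -- `I_r × I_r` and has `L^1` norm `1`.
  set κ : G m × G m → ℂ := fun w => -((delta m r w.1 * delta m r w.2 : ℝ) : ℂ) with hκ
  have hκm : Measurable κ := by fun_prop
  have hδi : Integrable (fun w : G m × G m => delta m r w.1 * delta m r w.2) (haar2 m) :=
    (integrable_delta r).mul_prod (integrable_delta r)
  have hδ : ∫ w, delta m r w.1 * delta m r w.2 ∂haar2 m = 1 := by
    rw [haar2, integral_prod_mul (delta m r) (delta m r), integral_delta hm, one_mul]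
  have hκ1 : ∫⁻ w, ‖κ w‖ₑ ∂haar2 m = 1 := by
    have hκi : Integrable κ (haar2 m) := hδi.ofReal.neg
    rw [← ofReal_integral_norm_eq_lintegral_enorm hκi, ← ENNReal.ofReal_one, ← hδ]
    congr 1
    refine integral_congr_ae (Filter.Eventually.of_forall fun w => ?_)
    simp only [hκ]
    rw [norm_neg, Complex.norm_real, Real.norm_of_nonneg
      (mul_nonneg (delta_nonneg r _) (delta_nonneg r _))]
  have hκC : ∀ w, ‖κ w‖ ≤ (M m r : ℝ) * M m r := fun w => by
    simp only [hκ]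
    rw [norm_neg, Complex.norm_real, norm_mul]
    exact mul_le_mul (norm_delta_le r _) (norm_delta_le r _) (norm_nonneg _) (Nat.cast_nonneg _)
  have hrep : ∀ z, f z - partialSum m f (M m r) (M m r) z
      = ∫ w, (f (z + w) - f z) * κ w ∂haar2 m := by
    intro z
    have h1 : Integrable (fun w => f (z + w) * κ w) (haar2 m) :=
      integrable_mul_bounded (integrable_translate hf z) hκm hκC
    have h2 : Integrable (fun w => f z * κ w) (haar2 m) :=
      integrable_mul_bounded (integrable_const _) hκm hκC
    simp only [sub_mul]
    rw [integral_sub h1 h2, integral_const_mul, partialSum_eq_integral hf]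
    have h3 : ∫ w, κ w ∂haar2 m = -1 := by
      simp only [hκ]
      rw [integral_neg, integral_complex_ofReal, hδ, Complex.ofReal_one]
    rw [h3]
    simp only [hκ, dirichlet_M hm, mul_neg, integral_neg, map_mul, Complex.conj_ofReal,
      Complex.ofReal_mul]
    ring
  simp only [hrep]
  refine (eLpNorm_integral_mul_le (Φ := fun z w => f (z + w) - f z) hκm (by simp [hκ1]) ?_ hp
    (C := omega1 m f r p + omega2 m f r p) ?_).trans (by rw [hκ1, one_mul])
  · exact (hfm.comp (measurable_fst.add measurable_snd)).sub (hfm.comp measurable_fst)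
  · rintro ⟨u, v⟩ huv
    have hu : u ∈ I m r 0 := by
      by_contra h
      exact huv (by simp [hκ, delta_of_notMem h])
    have hv : v ∈ I m r 0 := by
      by_contra h
      exact huv (by simp [hκ, delta_of_notMem h])
    -- The increment by `(u, v)` is a `u`-increment seen at a point shifted by `(0, v)`, plus a
    -- `v`-increment; the shift does not change the norm.
    have e : (fun z : G m × G m => f (z + (u, v)) - f z)
        = (fun z => (fun z' : G m × G m => f (z'.1 + u, z'.2) - f z') (z + (0, v)))
          + fun z => f (z.1, z.2 + v) - f z := by
      ext ⟨x, y⟩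
      simp
    have hm1 : Measurable fun z' : G m × G m => f (z'.1 + u, z'.2) - f z' :=
      (hfm.comp (by fun_prop)).sub hfm
    have hm2 : Measurable fun z' : G m × G m => f (z'.1, z'.2 + v) - f z' :=
      (hfm.comp (by fun_prop)).sub hfm
    rw [e]
    refine (eLpNorm_add_le (hm1.comp (measurable_id.add_const (0, v))).aestronglyMeasurable
      hm2.aestronglyMeasurable hp).trans (add_le_add ?_ ?_)
    · refine (eLpNorm_translate hm1.aestronglyMeasurable p (0, v)).le.trans ?_
      exact le_iSup₂ (f := fun u (_ : u ∈ I m r 0) =>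
        eLpNorm (fun z : G m × G m => f (z.1 + u, z.2) - f z) p (haar2 m)) u hu
    · exact le_iSup₂ (f := fun v (_ : v ∈ I m r 0) =>
        eLpNorm (fun z : G m × G m => f (z.1, z.2 + v) - f z) p (haar2 m)) v hv

lemma integral_psi_mul_conj_psi (hm : ∀ k, 2 ≤ m k) (a b : ℕ) :
    ∫ x, psi m a x * (starRingEnd ℂ) (psi m b x) ∂haar m = if a = b then 1 else 0 := by
  split_ifs with h
  · subst h
    have hu : ∀ x : G m, psi m a x * (starRingEnd ℂ) (psi m a x) = 1 := fun x => by
      rw [Complex.mul_conj, Complex.normSq_eq_norm_sq, norm_psi]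
      simp
    simp [hu]
  · have := integral_mul_psi_mul_conj_psi hm (s := 0) h (by simp [M]) (by simp [M])
      (g := fun _ => 1) (by simp)
    simpa using this

lemma fourierCoeff_partialSum (hm : ∀ k, 2 ≤ m k) (N a b : ℕ) :
    fourierCoeff m (partialSum m f N N) a b
      = if a < N ∧ b < N then fourierCoeff m f a b else 0 := by
  have hi : ∀ k₁ k₂, Integrable (fun z : G m × G m => fourierCoeff m f k₁ k₂ *
      ((psi m k₁ z.1 * (starRingEnd ℂ) (psi m a z.1)) *
        (psi m k₂ z.2 * (starRingEnd ℂ) (psi m b z.2)))) (haar2 m) := fun k₁ k₂ => by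
    refine integrable_of_measurable_of_norm_le (by fun_prop) (C := ‖fourierCoeff m f k₁ k₂‖)
      fun z => ?_
    simp [norm_psi]
  have e : ∀ z : G m × G m, partialSum m f N N z * (starRingEnd ℂ) (psi m a z.1)
      * (starRingEnd ℂ) (psi m b z.2)
      = ∑ k₁ ∈ Finset.range N, ∑ k₂ ∈ Finset.range N, fourierCoeff m f k₁ k₂ *
      ((psi m k₁ z.1 * (starRingEnd ℂ) (psi m a z.1)) *
        (psi m k₂ z.2 * (starRingEnd ℂ) (psi m b z.2))) := by
    intro z
    simp only [partialSum, Finset.sum_mul]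
    exact Finset.sum_congr rfl fun _ _ => Finset.sum_congr rfl fun _ _ => by ring
  have v : ∀ k₁ k₂, ∫ z, fourierCoeff m f k₁ k₂ *
      ((psi m k₁ z.1 * (starRingEnd ℂ) (psi m a z.1)) *
        (psi m k₂ z.2 * (starRingEnd ℂ) (psi m b z.2))) ∂haar2 m
      = fourierCoeff m f k₁ k₂ * ((if k₁ = a then 1 else 0) * (if k₂ = b then 1 else 0)) := by
    intro k₁ k₂
    rw [integral_const_mul, haar2, integral_prod_mul
      (fun x => psi m k₁ x * (starRingEnd ℂ) (psi m a x))
      (fun y => psi m k₂ y * (starRingEnd ℂ) (psi m b y)), integral_psi_mul_conj_psi hm,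
      integral_psi_mul_conj_psi hm]
  rw [fourierCoeff]
  simp only [e]
  rw [integral_finsetSum _ fun k₁ _ => integrable_finsetSum _ fun k₂ _ => hi k₁ k₂]
  simp only [integral_finsetSum _ fun k₂ _ => hi _ k₂, v]
  by_cases ha : a < N <;> by_cases hb : b < N <;> simp [ha, hb]

lemma partialSum_partialSum (hm : ∀ k, 2 ≤ m k) {N j : ℕ} (h : N ≤ j) (z : G m × G m) :
    partialSum m (partialSum m f N N) j j z = partialSum m f N N z := by
  rw [partialSum]
  simp only [fourierCoeff_partialSum hm]
  rw [partialSum]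
  symm
  have hsub : Finset.range N ⊆ Finset.range j := Finset.range_mono h
  refine (Finset.sum_congr rfl fun a ha => ?_).trans (Finset.sum_subset hsub fun a _ ha => ?_)
  · refine (Finset.sum_congr rfl fun b hb => ?_).trans (Finset.sum_subset hsub fun b _ hb => ?_)
    · rw [if_pos ⟨Finset.mem_range.1 ha, Finset.mem_range.1 hb⟩]
    · rw [if_neg (fun h' => hb (Finset.mem_range.2 h'.2))]
      simp
  · refine Finset.sum_eq_zero fun b _ => ?_
    rw [if_neg (fun h' => ha (Finset.mem_range.2 h'.1))]
    simp

lemma integrable_partialSum (N : ℕ) : Integrable (partialSum m f N N) (haar2 m) := by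
  refine integrable_of_measurable_of_norm_le (measurable_partialSum N N)
    (C := ∑ a ∈ Finset.range N, ∑ b ∈ Finset.range N, ‖fourierCoeff m f a b‖) fun z => ?_
  refine (norm_sum_le _ _).trans (Finset.sum_le_sum fun a _ => ?_)
  refine (norm_sum_le _ _).trans (Finset.sum_le_sum fun b _ => ?_)
  simp [norm_psi]

/-- As `S_{j,j}` fixes `S_{N,N} f` for `N ≤ j`, only the remainder `f - S_{N,N} f` matters, and its
norm is controlled by the moduli of continuity when `N` is some `M_r`. -/
lemma partialSum_sub_self (hm : ∀ k, 2 ≤ m k) (hf : Integrable f (haar2 m)) {N j : ℕ} (h : N ≤ j)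
    (z : G m × G m) :
    partialSum m (fun z => f z - partialSum m f N N z) j j z - (f z - partialSum m f N N z)
      = partialSum m f j j z - f z := by
  have hb := norm_dirichlet_mul_le (m := m) j
  have hd : partialSum m (fun z => f z - partialSum m f N N z) j j z
      = partialSum m f j j z - partialSum m f N N z := by
    have hN := integrable_partialSum (f := f) N
    conv_rhs => rw [← partialSum_partialSum hm h]
    rw [partialSum_eq_integral (f := fun z => f z - partialSum m f N N z) (hf.sub hN),
      partialSum_eq_integral hf, partialSum_eq_integral hN, ← integral_sub]
    · simp only [sub_mul]
    · exact integrable_mul_bounded (integrable_translate hf z) (by fun_prop) hb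
    · exact integrable_mul_bounded (integrable_translate hN z) (by fun_prop) hb
  rw [hd]
  ring

end Convolution

end Vilenkin

namespace Vilenkin

/-! ### Block decomposition of `σ_n f - f` and the final estimate. -/

section Approximation

variable {m : ℕ → ℕ}

lemma ofReal_mul_ofReal_mul_le {a b c d : ℝ} (ha : 0 ≤ a) (hc : 0 ≤ c) (h : a * b ≤ c * d)
    (X : ℝ≥0∞) :
    ENNReal.ofReal a * (ENNReal.ofReal b * X) ≤ ENNReal.ofReal c * (ENNReal.ofReal d * X) := by
  rw [← mul_assoc, ← mul_assoc, ← ENNReal.ofReal_mul ha, ← ENNReal.ofReal_mul hc]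
  gcongr

lemma sum_Ico_M (hm : ∀ k, 2 ≤ m k) {E : Type*} [AddCommMonoid E] (g : ℕ → E) (K : ℕ) :
    ∑ j ∈ Finset.Ico 1 (M m K), g j
      = ∑ r ∈ Finset.range K, ∑ j ∈ Finset.Ico (M m r) (M m (r + 1)), g j := by
  induction K with
  | zero => simp [M]
  | succ K ih =>
    rw [Finset.sum_range_succ, ← ih, Finset.sum_Ico_consecutive _ (M_pos hm K)
      (M_le_M hm (Nat.le_succ K))]

/-- Since `2 M_{k-1} ≤ M_k`, the index `n - j` is at least `M_k / 2`; the constant is `2^{α+1} ≤ 4`.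
-/
lemma abs_cesaroA_sub_le {α : ℝ} (h0 : 0 < α) (h1 : α < 1) (hm : ∀ k, 2 ≤ m k) {k n j : ℕ}
    (hk : 1 ≤ k) (hn : M m k ≤ n) (hj : j < M m (k - 1)) :
    |cesaroA (-α - 1) (n - j)| ≤ 4 * ((M m k : ℝ) ^ (-α) / M m k) := by
  have h2 : 2 * M m (k - 1) ≤ M m k := by
    obtain ⟨k, rfl⟩ := Nat.exists_eq_add_of_le' hk
    exact Nat.mul_le_mul_right _ (hm k)
  have hM : (0 : ℝ) < M m k := by exact_mod_cast M_pos hm k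
  have hle : (M m k : ℝ) / 2 ≤ ((n - j : ℕ) : ℝ) := by
    rw [div_le_iff₀ (by norm_num)]
    exact_mod_cast (show M m k ≤ (n - j) * 2 by omega)
  refine (abs_cesaroA_sub_one_le h0 h1 (by omega)).trans ?_
  calc _ ≤ ((M m k : ℝ) / 2) ^ (-α - 1) :=
        Real.rpow_le_rpow_of_nonpos (by positivity) hle (by linarith)
    _ = 2 ^ (α + 1) * ((M m k : ℝ) ^ (-α) / M m k) := by
        rw [Real.div_rpow hM.le (by norm_num), Real.rpow_sub_one hM.ne',
          show -α - 1 = -(α + 1) by ring, Real.rpow_neg (by norm_num : (0 : ℝ) ≤ 2)]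
        field_simp
    _ ≤ _ := by
        gcongr
        calc (2 : ℝ) ^ (α + 1) ≤ 2 ^ (2 : ℝ) :=
              Real.rpow_le_rpow_of_exponent_le (by norm_num) (by linarith)
          _ = 4 := by norm_num

variable [∀ k, NeZero (m k)] {f : G m × G m → ℂ}

omit [∀ k, NeZero (m k)] in
lemma sigma_sub_self {α : ℝ} (h1 : α < 1) {n : ℕ} (hn : 1 ≤ n) (z : G m × G m) :
    sigma m α n f z - f z = ((cesaroA (-α) (n - 1))⁻¹ : ℝ) *
      ∑ j ∈ Finset.Ico 1 (n + 1), (cesaroA (-α - 1) (n - j) : ℂ) * (partialSum m f j j z - f z) := by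
  have hA : (cesaroA (-α) (n - 1) : ℂ) ≠ 0 := by
    exact_mod_cast (cesaroA_neg_pos h1 (n - 1)).ne'
  have hs : ∑ j ∈ Finset.Ico 1 (n + 1), (cesaroA (-α - 1) (n - j) : ℂ)
      = cesaroA (-α) (n - 1) := by
    rw [← sum_cesaroA_sub_one, Nat.sub_add_cancel hn, Finset.sum_Ico_eq_sum_range,
      Nat.add_sub_cancel, ← Finset.sum_range_reflect]
    push_cast
    refine Finset.sum_congr rfl fun j hj => ?_
    simp at hj
    congr 2
    omega
  have hI : Finset.Icc 1 n = Finset.Ico 1 (n + 1) := by ext; simp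
  simp only [mul_sub, Finset.sum_sub_distrib]
  rw [← Finset.sum_mul, hs, sigma, hI]
  push_cast
  field_simp

lemma eLpNorm_sum_mul_const_le {X : Type*} [MeasurableSpace X] {μ : Measure X} (S : Finset ℕ)
    (c : ℕ → ℝ) {V : ℝ} (hV : ∑ j ∈ S, |c j| ≤ V) (h : X → ℂ) (p : ℝ≥0∞) :
    eLpNorm (fun z => ∑ j ∈ S, (c j : ℂ) * h z) p μ ≤ ENNReal.ofReal V * eLpNorm h p μ := by
  have e : (fun z => ∑ j ∈ S, (c j : ℂ) * h z) = (∑ j ∈ S, (c j : ℂ)) • h := by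
    ext z
    simp [Finset.sum_mul]
  rw [e, eLpNorm_const_smul, ← ofReal_norm]
  gcongr
  refine (norm_sum_le _ _).trans (le_trans (le_of_eq ?_) hV)
  simp

/-- Differences of partial sums over a block of indices below `M_{r+1}`. -/
lemma eLpNorm_block_le (hm : ∀ k, 2 ≤ m k) {B : ℕ} (hB : ∀ k, m k ≤ B) (hfm : Measurable f)
    (hf : Integrable f (haar2 m)) {p : ℝ≥0∞} (hp : 1 ≤ p) {c : ℕ → ℝ} {W : ℝ} (hW : 0 < W) (r : ℕ)
    (hc : ∀ j < M m (r + 1), |c j| ≤ W) :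
    eLpNorm (fun z => ∑ j ∈ Finset.Ico (M m r) (M m (r + 1)),
        (c j : ℂ) * (partialSum m f j j z - f z)) p (haar2 m)
      ≤ ENNReal.ofReal ((quadConst B + 1) * (W * M m (r + 1)))
        * (omega1 m f r p + omega2 m f r p) := by
  set h : G m × G m → ℂ := fun z => f z - partialSum m f (M m r) (M m r) z with hh
  have hhm : Measurable h := hfm.sub (measurable_partialSum _ _)
  have hhi : Integrable h (haar2 m) := hf.sub (integrable_partialSum _)
  -- Setting the weights below `M_r` to zero turns the block into a sum over all `j < M_{r+1}` with
  -- the same sup bound, as the kernel estimate requires.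
  set c' : ℕ → ℝ := fun j => if M m r ≤ j then c j else 0 with hc'
  have hc'W : ∀ j < M m (r + 1), |c' j| ≤ W := by
    intro j hj
    simp only [hc']
    split_ifs
    · exact hc j hj
    · simpa using hW.le
  have hIco : Finset.Ico (M m r) (M m (r + 1))
      = (Finset.range (M m (r + 1))).filter (M m r ≤ ·) := by
    ext j; simp [and_comm]
  have e : (fun z => ∑ j ∈ Finset.Ico (M m r) (M m (r + 1)),
        (c j : ℂ) * (partialSum m f j j z - f z))
      = (fun z => ∑ j ∈ Finset.range (M m (r + 1)), (c' j : ℂ) * partialSum m h j j z)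
        - fun z => ∑ j ∈ Finset.range (M m (r + 1)), (c' j : ℂ) * h z := by
    ext z
    rw [Pi.sub_apply, ← Finset.sum_sub_distrib, hIco, Finset.sum_filter]
    refine Finset.sum_congr rfl fun j _ => ?_
    simp only [hc']
    split_ifs with hj
    · rw [← partialSum_sub_self hm hf hj]
      ring
    · simp
  have hω := eLpNorm_sub_partialSum_M_le hm hfm hf hp r
  rw [e]
  refine (eLpNorm_sub_le (Measurable.aestronglyMeasurable (by fun_prop))
    (Measurable.aestronglyMeasurable (by fun_prop)) hp).trans ?_
  have hq := quadConst_pos B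
  rw [add_mul (quadConst B), one_mul, ENNReal.ofReal_add (by positivity) (by positivity), add_mul]
  refine add_le_add ?_ ?_
  · refine (eLpNorm_sum_mul_partialSum_le hhm hhi hp c' _).trans ?_
    gcongr
    exact integral_norm_quadKernel_le hm hB hW (r + 1) hc'W
  · refine (eLpNorm_sum_mul_const_le _ c' (V := W * M m (r + 1)) ?_ h p).trans ?_
    · refine (Finset.sum_le_sum fun j hj => hc'W j (Finset.mem_range.1 hj)).trans ?_
      simp [mul_comm]
    · gcongr

/-- The constant in the bound for the `L^1` norms of the Cesàro kernels. -/
noncomputable def cesaroConst (B : ℕ) (α : ℝ) : ℝ :=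
  (2 * (B + 1) + (B + 4) / (1 - α)) * (B + 1) * (2 / (1 - 2 ^ (-α)))

lemma cesaroConst_nonneg (B : ℕ) {α : ℝ} (h0 : 0 < α) (h1 : α < 1) : 0 ≤ cesaroConst B α := by
  have hα : (0 : ℝ) < 1 - α := by linarith
  have h2 : (2 : ℝ) ^ (-α) < 1 := Real.rpow_lt_one_of_one_lt_of_neg (by norm_num) (by linarith)
  have h3 : (0 : ℝ) < 1 - 2 ^ (-α) := by linarith
  unfold cesaroConst
  positivity

/-- Differences of partial sums over the last block of indices. -/
lemma eLpNorm_last_block_le {α : ℝ} (h0 : 0 < α) (h1 : α < 1) (hm : ∀ k, 2 ≤ m k) {B : ℕ}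
    (hB : ∀ k, m k ≤ B) (hfm : Measurable f) (hf : Integrable f (haar2 m)) {p : ℝ≥0∞} (hp : 1 ≤ p)
    {k n : ℕ} (hk : 1 ≤ k) (hn : M m k ≤ n) (hn' : n < M m (k + 1)) :
    eLpNorm (fun z => ∑ j ∈ Finset.Ico (M m (k - 1)) (n + 1),
        (cesaroA (-α - 1) (n - j) : ℂ) * (partialSum m f j j z - f z)) p (haar2 m)
      ≤ ENNReal.ofReal ((6 * cesaroConst B α + 4 * quadConst B + 4) * k)
        * (omega1 m f (k - 1) p + omega2 m f (k - 1) p) := by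
  set N := M m (k - 1) with hN
  have hNk : N ≤ M m k := M_le_M hm (Nat.sub_le _ _)
  have hM1 : (1 : ℝ) ≤ M m k := by exact_mod_cast M_pos hm k
  set h : G m × G m → ℂ := fun z => f z - partialSum m f N N z with hh
  have hhm : Measurable h := hfm.sub (measurable_partialSum _ _)
  have hhi : Integrable h (haar2 m) := hf.sub (integrable_partialSum _)
  set c : ℕ → ℝ := fun j => cesaroA (-α - 1) (n - j) with hc
  -- The last block is the complete Cesàro sum, with logarithmic kernel norm, minus the sum over `j
  -- < N`, where the weights are small, minus the multiple of `h` itself.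
  have e : (fun z => ∑ j ∈ Finset.Ico N (n + 1), (c j : ℂ) * (partialSum m f j j z - f z))
      = ((fun z => ∑ j ∈ Finset.range (n + 1), (c j : ℂ) * partialSum m h j j z)
        - fun z => ∑ j ∈ Finset.range N, (c j : ℂ) * partialSum m h j j z)
        - fun z => ∑ j ∈ Finset.Ico N (n + 1), (c j : ℂ) * h z := by
    ext z
    rw [Pi.sub_apply, Pi.sub_apply, ← Finset.sum_Ico_eq_sub _ (by omega), ← Finset.sum_sub_distrib]
    refine Finset.sum_congr rfl fun j hj => ?_
    rw [← partialSum_sub_self hm hf (Finset.mem_Ico.1 hj).1, mul_sub]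
  have hω := eLpNorm_sub_partialSum_M_le hm hfm hf hp (k - 1)
  have hq := (quadConst_pos B).le
  have hC := cesaroConst_nonneg B h0 h1
  have hk' : (1 : ℝ) ≤ k := by exact_mod_cast hk
  rw [e]
  refine (eLpNorm_sub_le (Measurable.aestronglyMeasurable (by fun_prop))
    (Measurable.aestronglyMeasurable (by fun_prop)) hp).trans ?_
  have t1 : eLpNorm ((fun z => ∑ j ∈ Finset.range (n + 1), (c j : ℂ) * partialSum m h j j z)
        - fun z => ∑ j ∈ Finset.range N, (c j : ℂ) * partialSum m h j j z) p (haar2 m)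
      ≤ ENNReal.ofReal (cesaroConst B α * (6 * k) + 2) * eLpNorm h p (haar2 m)
        + ENNReal.ofReal (quadConst B * 4) * eLpNorm h p (haar2 m) := by
    refine (eLpNorm_sub_le (Measurable.aestronglyMeasurable (by fun_prop))
      (Measurable.aestronglyMeasurable (by fun_prop)) hp).trans (add_le_add ?_ ?_)
    · refine (eLpNorm_sum_mul_partialSum_le hhm hhi hp c _).trans ?_
      gcongr
      have := integral_norm_cesaroKernel_le h0 h1 hm hB hn'.le
      simp only [cesaroKernel_eq_quadKernel] at this
      refine this.trans ?_
      rw [← cesaroConst]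
      -- The kernel bound is applied with `K = k + 1`, since `n < M_{k+1}`; `k ≥ 1` lets `k` absorb
      -- the constants.
      have hk3 : 2 * (((k + 1 : ℕ) : ℝ) + 1) ≤ 6 * k := by
        push_cast
        linarith
      exact add_le_add_left (mul_le_mul_of_nonneg_left hk3 hC) _
    · refine (eLpNorm_sum_mul_partialSum_le hhm hhi hp c _).trans ?_
      gcongr
      have hW : (0 : ℝ) < 4 * ((M m k : ℝ) ^ (-α) / M m k) := by positivity
      refine (integral_norm_quadKernel_le hm hB hW (k - 1) fun j hj =>
        abs_cesaroA_sub_le h0 h1 hm hk hn hj).trans ?_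
      gcongr
      calc 4 * ((M m k : ℝ) ^ (-α) / M m k) * (M m (k - 1) : ℕ)
          ≤ 4 * (1 / M m k) * M m k := by
            gcongr
            exact Real.rpow_le_one_of_one_le_of_nonpos hM1 (by linarith)
        _ = 4 := by field_simp
  have t2 : eLpNorm (fun z => ∑ j ∈ Finset.Ico N (n + 1), (c j : ℂ) * h z) p (haar2 m)
      ≤ ENNReal.ofReal 2 * eLpNorm h p (haar2 m) := by
    refine eLpNorm_sum_mul_const_le _ c ?_ h p
    calc _ ≤ ∑ j ∈ Finset.range (n + 1), |c j| := by
          refine Finset.sum_le_sum_of_subset_of_nonneg ?_ fun _ _ _ => abs_nonneg _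
          intro j hj
          simp at hj ⊢
          omega
      _ ≤ 2 := by
          rw [← Finset.sum_range_reflect]
          refine le_trans (le_of_eq ?_) (sum_range_abs_cesaroA_le h0 h1 (n + 1))
          refine Finset.sum_congr rfl fun j hj => ?_
          simp only [hc]
          congr 2
          simp at hj
          omega
  refine (add_le_add t1 t2).trans ?_
  rw [← add_mul, ← add_mul, ← ENNReal.ofReal_add (by positivity) (by positivity),
    ← ENNReal.ofReal_add (by positivity) (by positivity)]
  gcongr
  nlinarith

lemma eLpNorm_sigma_sub_le {α : ℝ} (h0 : 0 < α) (h1 : α < 1) (hm : ∀ k, 2 ≤ m k) {B : ℕ}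
    (hB : ∀ k, m k ≤ B) (hfm : Measurable f) (hf : Integrable f (haar2 m)) {p : ℝ≥0∞} (hp : 1 ≤ p)
    {k n : ℕ} (hk : 1 ≤ k) (hn : M m k ≤ n) (hn' : n < M m (k + 1)) :
    eLpNorm (fun z => sigma m α n f z - f z) p (haar2 m) ≤
      ENNReal.ofReal (B / (1 - α) * (2 * (6 * cesaroConst B α + 4 * quadConst B + 4)
          + 4 * B * (quadConst B + 1))) *
        (ENNReal.ofReal ((M m k : ℝ) ^ α * Real.log n) *
            (omega1 m f (k - 1) p + omega2 m f (k - 1) p) +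
          ∑ r ∈ Finset.range (k - 1), ENNReal.ofReal ((M m r : ℝ) / (M m k : ℝ)) *
            (omega1 m f r p + omega2 m f r p)) := by
  have hα : (0 : ℝ) < 1 - α := by linarith
  have hn1 : 1 ≤ n := (M_pos hm k).trans_le hn
  have hM : (0 : ℝ) < M m k := by exact_mod_cast M_pos hm k
  have hB1 : (1 : ℝ) ≤ B := by exact_mod_cast (show 1 ≤ B by have := hm 0; have := hB 0; omega)
  set D : ℝ := 6 * cesaroConst B α + 4 * quadConst B + 4 with hD
  have hq := (quadConst_pos B).le
  have hC := cesaroConst_nonneg B h0 h1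
  have hD0 : 0 ≤ D := by positivity
  set W : ℝ := 4 * ((M m k : ℝ) ^ (-α) / M m k) with hWdef
  have hW : 0 < W := by positivity
  set A := cesaroA (-α) (n - 1) with hA
  have hA0 : 0 < A := cesaroA_neg_pos h1 _
  -- The lower bound for `A_{n-1}^{-α}` gives `n^α / (1 - α)`; then `n ≤ B M_k` and `B^α ≤ B`.
  have hAinv : A⁻¹ ≤ B / (1 - α) * (M m k : ℝ) ^ α := by
    have h3 := le_cesaroA_neg h0 h1 (n - 1)
    have hn0 : (0 : ℝ) < n := by exact_mod_cast hn1
    rw [Nat.cast_sub hn1, Nat.cast_one, sub_add_cancel, ← hA] at h3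
    calc A⁻¹ ≤ ((1 - α) * (n : ℝ) ^ (-α))⁻¹ := inv_anti₀ (by positivity) h3
      _ = (n : ℝ) ^ α / (1 - α) := by
          rw [Real.rpow_neg hn0.le, mul_inv, inv_inv, mul_comm, div_eq_mul_inv]
      _ ≤ (B * M m k : ℝ) ^ α / (1 - α) := by
          gcongr
          have : n ≤ B * M m k := hn'.le.trans (Nat.mul_le_mul_right _ (hB k))
          exact_mod_cast this
      _ ≤ (B * (M m k : ℝ) ^ α) / (1 - α) := by
          rw [Real.mul_rpow (by positivity) hM.le]
          gcongr
          calc (B : ℝ) ^ α ≤ (B : ℝ) ^ (1 : ℝ) := Real.rpow_le_rpow_of_exponent_le hB1 h1.le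
            _ = B := Real.rpow_one _
      _ = _ := by ring
  -- From `2^k ≤ M_k ≤ n` and `log 2 ≥ 1/2`.
  have hlog : (k : ℝ) ≤ 2 * Real.log n := by
    have h2k : (2 : ℝ) ^ k ≤ n := by
      have := two_pow_mul_M_le hm 0 k
      simp only [M, mul_one, zero_add] at this
      exact_mod_cast this.trans hn
    have h4 := Real.log_le_log (by positivity) h2k
    rw [Real.log_pow] at h4
    have h5 := Real.log_two_gt_d9
    have hk0 : (0 : ℝ) ≤ k := Nat.cast_nonneg k
    nlinarith
  set g : ℕ → G m × G m → ℂ := fun j z =>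
    (cesaroA (-α - 1) (n - j) : ℂ) * (partialSum m f j j z - f z) with hg
  have hgm : ∀ j, Measurable (g j) := fun j => by
    simp only [hg]
    fun_prop
  have e : (fun z => sigma m α n f z - f z) = ((A⁻¹ : ℝ) : ℂ) •
      ((∑ r ∈ Finset.range (k - 1), fun z => ∑ j ∈ Finset.Ico (M m r) (M m (r + 1)), g j z)
        + fun z => ∑ j ∈ Finset.Ico (M m (k - 1)) (n + 1), g j z) := by
    ext z
    rw [sigma_sub_self h1 hn1]
    simp only [Pi.smul_apply, Pi.add_apply, Finset.sum_apply, smul_eq_mul]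
    rw [← sum_Ico_M hm (fun j => g j z) (k - 1), Finset.sum_Ico_consecutive _ (M_pos hm (k - 1))
      (((M_le_M hm (Nat.sub_le k 1)).trans hn).trans (Nat.le_succ n))]
  have hblock : ∀ r ∈ Finset.range (k - 1),
      eLpNorm (fun z => ∑ j ∈ Finset.Ico (M m r) (M m (r + 1)), g j z) p (haar2 m)
        ≤ ENNReal.ofReal ((quadConst B + 1) * (W * M m (r + 1)))
          * (omega1 m f r p + omega2 m f r p) := fun r hr =>
    eLpNorm_block_le hm hB hfm hf hp hW r fun j hj =>
      abs_cesaroA_sub_le h0 h1 hm hk hn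
        (hj.trans_le (M_le_M hm (by simp at hr; omega)))
  have hlast := eLpNorm_last_block_le h0 h1 hm hB hfm hf hp hk hn hn'
  have hgS : ∀ S : Finset ℕ, Measurable fun z => ∑ j ∈ S, g j z := fun S =>
    Finset.measurable_sum _ fun j _ => hgm j
  rw [e, eLpNorm_const_smul, ← ofReal_norm, Complex.norm_real,
    Real.norm_of_nonneg (inv_nonneg.2 hA0.le)]
  calc _ ≤ ENNReal.ofReal A⁻¹ * (∑ r ∈ Finset.range (k - 1),
          ENNReal.ofReal ((quadConst B + 1) * (W * M m (r + 1)))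
            * (omega1 m f r p + omega2 m f r p)
        + ENNReal.ofReal (D * k) * (omega1 m f (k - 1) p + omega2 m f (k - 1) p)) := by
        gcongr
        refine (eLpNorm_add_le (Finset.aestronglyMeasurable_sum _ fun r _ =>
          (hgS _).aestronglyMeasurable) (hgS _).aestronglyMeasurable hp).trans
          (add_le_add ?_ hlast)
        exact (eLpNorm_sum_le (fun r _ => (hgS _).aestronglyMeasurable) hp).trans
          (Finset.sum_le_sum hblock)
    _ ≤ _ := by
        rw [mul_add, add_comm, mul_add (ENNReal.ofReal (B / (1 - α) * _)), Finset.mul_sum,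
          Finset.mul_sum]
        refine add_le_add ?_ (Finset.sum_le_sum fun r _ => ?_)
        · refine ofReal_mul_ofReal_mul_le (inv_nonneg.2 hA0.le) (by positivity) ?_ _
          have hl0 : 0 ≤ Real.log n := Real.log_natCast_nonneg n
          calc A⁻¹ * (D * k) ≤ (B / (1 - α) * (M m k : ℝ) ^ α) * (D * (2 * Real.log n)) := by
                gcongr
            _ = B / (1 - α) * (2 * D) * ((M m k : ℝ) ^ α * Real.log n) := by ring
            _ ≤ _ := by
                gcongr
                have : (0 : ℝ) ≤ 4 * B * (quadConst B + 1) := by positivity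
                linarith
        -- The factor `M_k^α` from `A⁻¹` cancels the `M_k^{-α}` in `W`, leaving `M_{r+1} / M_k ≤ B
        -- M_r / M_k`.
        · refine ofReal_mul_ofReal_mul_le (inv_nonneg.2 hA0.le) (by positivity) ?_ _
          have hMr : (M m (r + 1) : ℝ) ≤ B * M m r := by
            exact_mod_cast Nat.mul_le_mul_right _ (hB r)
          calc A⁻¹ * ((quadConst B + 1) * (W * M m (r + 1)))
              ≤ (B / (1 - α) * (M m k : ℝ) ^ α)
                * ((quadConst B + 1) * (W * (B * M m r))) := by gcongr
            _ = B / (1 - α) * (4 * B * (quadConst B + 1)) * ((M m r : ℝ) / M m k) := by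
                rw [hWdef, Real.rpow_neg hM.le]
                have : (M m k : ℝ) ^ α ≠ 0 := by positivity
                field_simp
            _ ≤ _ := by
                gcongr
                linarith

end Approximation

/-! ### Independence of the choice of representative. -/

section AlmostEverywhere

variable {m : ℕ → ℕ} [∀ k, NeZero (m k)] {f g : G m × G m → ℂ}

omit [∀ k, NeZero (m k)] in
lemma sigma_congr_ae (h : f =ᵐ[haar2 m] g) (α : ℝ) (n : ℕ) (z : G m × G m) :
    sigma m α n f z = sigma m α n g z := by
  have hc : ∀ a b, fourierCoeff m f a b = fourierCoeff m g a b := fun a b =>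
    integral_congr_ae (h.mono fun w hw => by simp only [hw])
  simp only [sigma, partialSum, hc]

lemma ae_eq_translate (h : f =ᵐ[haar2 m] g) (w : G m × G m) :
    (fun z => f (z + w)) =ᵐ[haar2 m] fun z => g (z + w) := by
  have := (measurePreserving_add_left (haar2 m) w).quasiMeasurePreserving.ae_eq_comp h
  simpa only [Function.comp_def, add_comm w] using this

lemma omega1_congr_ae (h : f =ᵐ[haar2 m] g) (n : ℕ) (p : ℝ≥0∞) :
    omega1 m f n p = omega1 m g n p := by
  refine iSup_congr fun u => iSup_congr fun _ => eLpNorm_congr_ae ?_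
  filter_upwards [h, ae_eq_translate h (u, 0)] with z h1 h2
  simp only [Prod.add_def, add_zero] at h2
  rw [h1, h2]

lemma omega2_congr_ae (h : f =ᵐ[haar2 m] g) (n : ℕ) (p : ℝ≥0∞) :
    omega2 m f n p = omega2 m g n p := by
  refine iSup_congr fun v => iSup_congr fun _ => eLpNorm_congr_ae ?_
  filter_upwards [h, ae_eq_translate h (0, v)] with z h1 h2
  simp only [Prod.add_def, add_zero] at h2
  rw [h1, h2]

end AlmostEverywhere

end Vilenkin

theorem theorem2 (B : ℕ) (α : ℝ) (hα : α ∈ Set.Ioo (0 : ℝ) 1) :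
    ∃ c : ℝ≥0, ∀ m : ℕ → ℕ, (∀ k, 2 ≤ m k) → (∀ k, m k ≤ B) →
      ∀ (p : ℝ≥0∞) (f : Vilenkin.G m × Vilenkin.G m → ℂ), 1 ≤ p → Vilenkin.InLp m p f →
        ∀ k n : ℕ, 1 ≤ k → Vilenkin.M m k ≤ n → n < Vilenkin.M m (k + 1) →
          eLpNorm (fun z => Vilenkin.sigma m α n f z - f z) p (Vilenkin.haar2 m) ≤
            (c : ℝ≥0∞) *
              (ENNReal.ofReal ((Vilenkin.M m k : ℝ) ^ α * Real.log n) *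
                  (Vilenkin.omega1 m f (k - 1) p + Vilenkin.omega2 m f (k - 1) p) +
                ∑ r ∈ Finset.range (k - 1),
                  ENNReal.ofReal ((Vilenkin.M m r : ℝ) / (Vilenkin.M m k : ℝ)) *
                    (Vilenkin.omega1 m f r p + Vilenkin.omega2 m f r p)) := by
  refine ⟨(B / (1 - α) * (2 * (6 * Vilenkin.cesaroConst B α + 4 * Vilenkin.quadConst B + 4)
    + 4 * B * (Vilenkin.quadConst B + 1))).toNNReal, ?_⟩
  intro m hm hB p f hp hf k n hk hn hn'
  have : ∀ k, NeZero (m k) := fun k => ⟨by have := hm k; omega⟩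
  -- Tonelli in `f (z + w)` needs a measurable function; all quantities in the estimate depend only
  -- on the almost-everywhere class, so a measurable representative may be used.
  obtain ⟨g, hgm, hfg⟩ := hf.1.1
  have hg : Integrable g (Vilenkin.haar2 m) := (hf.1.ae_eq hfg).integrable hp
  have key := Vilenkin.eLpNorm_sigma_sub_le hα.1 hα.2 hm hB hgm.measurable hg hp hk hn hn'
  have e : eLpNorm (fun z => Vilenkin.sigma m α n f z - f z) p (Vilenkin.haar2 m)
      = eLpNorm (fun z => Vilenkin.sigma m α n g z - g z) p (Vilenkin.haar2 m) := by
    refine eLpNorm_congr_ae (hfg.mono fun z hz => ?_)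
    simp only [Vilenkin.sigma_congr_ae hfg, hz]
  rw [e]
  simp only [Vilenkin.omega1_congr_ae hfg, Vilenkin.omega2_congr_ae hfg]
  exact key
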